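/- Let $M=(M_e\xrightarrow{H}M_{ee}\xrightarrow{P}M_e)$ be a quadratic $\mathbb Z$-module, i.e. a diagram of abelian groups with $HPH=2H$ and $PHP=2P$. For an abelian group $A$, let $A\otimes M$ be the abelian group with generators $a\otimes m$, $[a,b]\otimes n$ ($a,b\in A$, $m\in M_e$, $n\in M_{ee}$), where $a\otimes m$ is linear in $m$ and $[a,b]\otimes n$ is linear in $a$, $b$ and $n$, with the relations $(a+b)\otimes m=a\otimes m+b\otimes m+[a,b]\otimes Hm$ and $[a,a]\otimes n=a\otimes Pn$. It comes with natural homomorphisms $A\otimes M\xrightarrow{H}A\otimes A\otimes M_{ee}\xrightarrow{P}A\otimes M$ induced by the diagonal and the folding map, $H(a\otimes m)=a\otimes a\otimes Hm$, $H([a,b]\otimes n)=a\otimes b\otimes n+b\otimes a\otimes(HPn-n)$, $P(a\otimes b\otimes n)=[a,b]\otimes n$. Let $r\ge 0$. A graded abelian group or a chain complex of abelian groups, graded by $\mathbb Z$, is $r$-reduced if it vanishes in degrees $<r$. For $Y$ vanishing in negative degrees put $M_\#Y=N((N^{-1}Y)\otimes M)$, where $N$ is the normalization (Moore complex) functor of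 the Dold–Kan equivalence. Similarly, for chain maps $f,g:Y\to Y'$ one has $f\otimes g:M_\#(Y|Y)\to M_\#(Y'|Y')$, where $M_\#(Y|Y)=N((N^{-1}Y)\otimes (N^{-1}Y)\otimes M_{ee})$, and the chain maps $M_\#Y\xrightarrow{H}M_\#(Y|Y)\xrightarrow{P}M_\#Y$. For an abelian group $A$ let $C(A,n)$ be a functorial short free resolution of $A$, placed in degrees $n+1$ and $n$, and for a graded abelian group $B$ let $C(B)=\bigoplus_nC(B_n,n)$. The pseudo-homology $H_n(A,Z)=[C(A,n),Z]$ is the group of homotopy classes of chain maps; it has the universal coefficient sequence $\mathrm{Ext}(A,H_{n+1}Z)\overset{\Delta}{\rightarrowtail}H_n(A,Z)\overset{\mu}{\twoheadrightarrow}\mathrm{Hom}(A,H_nZ)$. For a graded abelian group $B$ and a chain complex $Z$, boundary invariants $(b,\beta)$ are sequences $b_n\in\mathrm{Hom}(B_n,H_{n-1}Z)$ and $\beta_n\in H_{n-1}(B_n,Z)/\Delta(b_{n+1})_*\mathrm{Ext}(B_n,B_{n+1})$ with $\mu\beta_n=b_n$. A homomorphism $\varphi:B\to B'$ and a chain map $\Phi:Z\to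 Z'$ are compatible with boundary invariants $(b,\beta)$ for $(B,Z)$ and $(b',\beta')$ for $(B',Z')$ if $\Phi_*b_n=b'_n\varphi$ for all $n$, and $\Phi_*\beta_n=\varphi^*\beta'_n$ in $H_{n-1}(B_n,Z')/\Delta(b'_{n+1})_*\mathrm{Ext}(B_n,B'_{n+1})$ for all $n$. The category $\mathsf{bype}_r(M)$: objects are triples $(Y,b,\beta)$, where $Y$ is an $r$-reduced chain complex of free abelian groups and $(b,\beta)$ are boundary invariants for $(H_*Y,M_\#Y)$; morphisms $(Y,b,\beta)\to(Y',b',\beta')$ are homotopy classes of chain maps $f:Y\to Y'$ for which $H_*f$ and $M_\#f$ are compatible with the boundary invariants. The category $\mathsf{Hbype}_r(M)$: objects are triples $(B,b,\beta)$, where $B$ is an $r$-reduced graded abelian group and $(b,\beta)$ are boundary invariants for $(B,M_\#C(B))$; morphisms $(B,b,\beta)\to(B',b',\beta')$ are homomorphisms $\varphi:B\to B'$ of graded abelian groups for which there is a chain map $\alpha:C(B)\to C(B')$ with $H_*(\alpha)=0$ such that $\varphi$ and the chain map $M_\#C(\varphi)+P(\alpha\otimes C(\varphi))H+M_\#(\alpha)$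 are compatible with the boundary invariants. **Proposition.** For each object $(Y,b,\beta)$ of $\mathsf{bype}_r(M)$ there is a weak equivalence $i:C(H_*Y)\to Y$ which induces the identity of $H_*Y$ in homology. For every choice of such chain maps $i=i_{(Y,b,\beta)}$ there is a functor $$h:\mathsf{bype}_r(M)\to\mathsf{Hbype}_r(M)$$ which carries $(Y,b,\beta)$ to $(H_*Y,b,\beta)$, where $b,\beta$ are regarded as boundary invariants for $(H_*Y,M_\#C(H_*Y))$ by means of $M_\#i:M_\#C(H_*Y)\to M_\#Y$ (that is, the identity of $H_*Y$ and $M_\#i$ are compatible with the boundary invariants of $h(Y,b,\beta)$ and of $(Y,b,\beta)$), and which carries a morphism $f$ to $H_*f$. The functor $h$ reflects isomorphisms, is representative (every object of $\mathsf{Hbype}_r(M)$ is isomorphic to some $h(Y,b,\beta)$), and is full. -/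

import Mathlib

open CategoryTheory Limits
open scoped TensorProduct

universe u

namespace QuadBype

/-! ### Quadratic modules and the quadratic tensor product -/

/-- A quadratic `ℤ`-module `M = (Mₑ → Mₑₑ → Mₑ)`, i.e. abelian groups with homomorphisms
`H`, `P` such that `HPH = 2H` and `PHP = 2P`. -/
structure QuadraticModule where
  e : Type u
  ee : Type u
  [addCommGroup_e : AddCommGroup e]
  [addCommGroup_ee : AddCommGroup ee]
  H : e →+ ee
  P : ee →+ e
  HPH : ∀ m, H (P (H m)) = 2 • H m
  PHP : ∀ n, P (H (P n)) = 2 • P n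

attribute [instance] QuadraticModule.addCommGroup_e QuadraticModule.addCommGroup_ee

variable (M : QuadraticModule.{u})

section Tensor

/-- The generators `a ⊗ m` (left summand) and `[a, b] ⊗ n` (right summand) of `A ⊗ M`. -/
abbrev TensorGen (A : Type u) : Type u := (A × M.e) ⊕ (A × A × M.ee)

/-- The generator `a ⊗ m`, in the free abelian group. -/
def genE {A : Type u} (a : A) (m : M.e) : FreeAbelianGroup (TensorGen M A) :=
  FreeAbelianGroup.of (Sum.inl (a, m))

/-- The generator `[a, b] ⊗ n`, in the free abelian group. -/
def genEE {A : Type u} (a b : A) (n : M.ee) : FreeAbelianGroup (TensorGen M A) :=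
  FreeAbelianGroup.of (Sum.inr (a, b, n))

/-- The defining relators of `A ⊗ M`. -/
inductive TensorRel (A : Type u) [AddCommGroup A] : FreeAbelianGroup (TensorGen M A) → Prop
  | e_add (a : A) (m m' : M.e) :
      TensorRel A (genE M a (m + m') - genE M a m - genE M a m')
  | ee_add_left (a a' b : A) (n : M.ee) :
      TensorRel A (genEE M (a + a') b n - genEE M a b n - genEE M a' b n)
  | ee_add_right (a b b' : A) (n : M.ee) :
      TensorRel A (genEE M a (b + b') n - genEE M a b n - genEE M a b' n)
  | ee_add (a b : A) (n n' : M.ee) :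
      TensorRel A (genEE M a b (n + n') - genEE M a b n - genEE M a b n')
  | add_e (a b : A) (m : M.e) :
      TensorRel A (genE M (a + b) m - genE M a m - genE M b m - genEE M a b (M.H m))
  | diag (a : A) (n : M.ee) :
      TensorRel A (genEE M a a n - genE M a (M.P n))

/-- The quadratic tensor product `A ⊗ M`. -/
abbrev QTensor (A : Type u) [AddCommGroup A] : Type u :=
  FreeAbelianGroup (TensorGen M A) ⧸ AddSubgroup.closure {x | TensorRel M A x}

variable {A A' A'' : Type u} [AddCommGroup A] [AddCommGroup A'] [AddCommGroup A'']

/-- The element `a ⊗ m` of `A ⊗ M`. -/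
def tmulE (a : A) (m : M.e) : QTensor M A := QuotientAddGroup.mk (genE M a m)

/-- The element `[a, b] ⊗ n` of `A ⊗ M`. -/
def tmulEE (a b : A) (n : M.ee) : QTensor M A := QuotientAddGroup.mk (genEE M a b n)

lemma rel_eq_zero {x : FreeAbelianGroup (TensorGen M A)} (h : TensorRel M A x) :
    (QuotientAddGroup.mk x : QTensor M A) = 0 :=
  (QuotientAddGroup.eq_zero_iff _).2 (AddSubgroup.subset_closure h)

lemma tmulE_add (a : A) (m m' : M.e) : tmulE M a (m + m') = tmulE M a m + tmulE M a m' := by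
  have := rel_eq_zero M (TensorRel.e_add a m m')
  rw [sub_sub, QuotientAddGroup.mk_sub, sub_eq_zero] at this
  exact this

lemma tmulEE_add_left (a a' b : A) (n : M.ee) :
    tmulEE M (a + a') b n = tmulEE M a b n + tmulEE M a' b n := by
  have := rel_eq_zero M (TensorRel.ee_add_left a a' b n)
  rw [sub_sub, QuotientAddGroup.mk_sub, sub_eq_zero] at this
  exact this

lemma tmulEE_add_right (a b b' : A) (n : M.ee) :
    tmulEE M a (b + b') n = tmulEE M a b n + tmulEE M a b' n := by
  have := rel_eq_zero M (TensorRel.ee_add_right a b b' n)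
  rw [sub_sub, QuotientAddGroup.mk_sub, sub_eq_zero] at this
  exact this

lemma tmulEE_add (a b : A) (n n' : M.ee) :
    tmulEE M a b (n + n') = tmulEE M a b n + tmulEE M a b n' := by
  have := rel_eq_zero M (TensorRel.ee_add a b n n')
  rw [sub_sub, QuotientAddGroup.mk_sub, sub_eq_zero] at this
  exact this

lemma add_tmulE (a b : A) (m : M.e) :
    tmulE M (a + b) m = tmulE M a m + tmulE M b m + tmulEE M a b (M.H m) := by
  have := rel_eq_zero M (TensorRel.add_e a b m)
  rw [sub_sub, sub_sub, QuotientAddGroup.mk_sub, sub_eq_zero, ← add_assoc] at this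
  exact this

lemma tmulEE_self (a : A) (n : M.ee) : tmulEE M a a n = tmulE M a (M.P n) := by
  have := rel_eq_zero M (TensorRel.diag a n)
  rw [QuotientAddGroup.mk_sub, sub_eq_zero] at this
  exact this

/-- The universal property of `A ⊗ M`. -/
def QTensor.lift {G : Type u} [AddCommGroup G] (f : A → M.e → G) (g : A → A → M.ee → G)
    (h1 : ∀ a m m', f a (m + m') = f a m + f a m')
    (h2 : ∀ a a' b n, g (a + a') b n = g a b n + g a' b n)
    (h3 : ∀ a b b' n, g a (b + b') n = g a b n + g a b' n)
    (h4 : ∀ a b n n', g a b (n + n') = g a b n + g a b n')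
    (h5 : ∀ a b m, f (a + b) m = f a m + f b m + g a b (M.H m))
    (h6 : ∀ a n, g a a n = f a (M.P n)) : QTensor M A →+ G :=
  QuotientAddGroup.lift _
    (FreeAbelianGroup.lift (Sum.elim (fun x => f x.1 x.2) (fun x => g x.1 x.2.1 x.2.2))) (by
      rw [AddSubgroup.closure_le]
      intro x hx
      change FreeAbelianGroup.lift _ x = 0
      induction hx with
      | e_add a m m' => simp [genE, h1]
      | ee_add_left a a' b n => simp [genEE, h2]
      | ee_add_right a b b' n => simp [genEE, h3]
      | ee_add a b n n' => simp [genEE, h4]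
      | add_e a b m => simp [genE, genEE, h5]; abel
      | diag a n => simp [genE, genEE, h6])

@[simp] lemma QTensor.lift_tmulE {G : Type u} [AddCommGroup G] (f : A → M.e → G)
    (g : A → A → M.ee → G) (h1 h2 h3 h4 h5 h6) (a : A) (m : M.e) :
    QTensor.lift M f g h1 h2 h3 h4 h5 h6 (tmulE M a m) = f a m := by
  simp [QTensor.lift, tmulE, genE]

@[simp] lemma QTensor.lift_tmulEE {G : Type u} [AddCommGroup G] (f : A → M.e → G)
    (g : A → A → M.ee → G) (h1 h2 h3 h4 h5 h6) (a b : A) (n : M.ee) :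
    QTensor.lift M f g h1 h2 h3 h4 h5 h6 (tmulEE M a b n) = g a b n := by
  simp [QTensor.lift, tmulEE, genEE]

lemma QTensor.hom_ext {G : Type u} [AddCommGroup G] {φ ψ : QTensor M A →+ G}
    (h1 : ∀ a m, φ (tmulE M a m) = ψ (tmulE M a m))
    (h2 : ∀ a b n, φ (tmulEE M a b n) = ψ (tmulEE M a b n)) : φ = ψ := by
  apply QuotientAddGroup.addMonoidHom_ext
  apply FreeAbelianGroup.lift_ext
  rintro (⟨a, m⟩ | ⟨a, b, n⟩)
  · exact h1 a m
  · exact h2 a b n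

/-- The homomorphism `f ⊗ M : A ⊗ M → A' ⊗ M` induced by `f : A → A'`. -/
def QTensor.map (f : A →+ A') : QTensor M A →+ QTensor M A' :=
  QTensor.lift M (fun a m => tmulE M (f a) m) (fun a b n => tmulEE M (f a) (f b) n)
    (fun _ _ _ => tmulE_add M _ _ _)
    (fun _ _ _ _ => by simp only [map_add, tmulEE_add_left])
    (fun _ _ _ _ => by simp only [map_add, tmulEE_add_right])
    (fun _ _ _ _ => tmulEE_add M _ _ _ _)
    (fun _ _ _ => by simp only [map_add, add_tmulE])
    (fun _ _ => tmulEE_self M _ _)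

@[simp] lemma QTensor.map_tmulE (f : A →+ A') (a : A) (m : M.e) :
    QTensor.map M f (tmulE M a m) = tmulE M (f a) m := by simp [QTensor.map]

@[simp] lemma QTensor.map_tmulEE (f : A →+ A') (a b : A) (n : M.ee) :
    QTensor.map M f (tmulEE M a b n) = tmulEE M (f a) (f b) n := by simp [QTensor.map]

/-- `A ⊗ A ⊗ Mₑₑ`. -/
abbrev SqTensor (A : Type u) [AddCommGroup A] : Type u := (A ⊗[ℤ] A) ⊗[ℤ] M.ee

/-- `f ⊗ g ⊗ Mₑₑ : A ⊗ A ⊗ Mₑₑ → A' ⊗ A' ⊗ Mₑₑ`. -/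
def SqTensor.map (f g : A →+ A') : SqTensor M A →+ SqTensor M A' :=
  (TensorProduct.map (TensorProduct.map f.toIntLinearMap g.toIntLinearMap)
    LinearMap.id).toAddMonoidHom

@[simp] lemma SqTensor.map_tmul (f g : A →+ A') (a b : A) (n : M.ee) :
    SqTensor.map M f g ((a ⊗ₜ[ℤ] b) ⊗ₜ[ℤ] n) = (f a ⊗ₜ[ℤ] g b) ⊗ₜ[ℤ] n := rfl

lemma SqTensor.hom_ext {G : Type u} [AddCommGroup G] {φ ψ : SqTensor M A →+ G}
    (h : ∀ (a b : A) (n : M.ee), φ ((a ⊗ₜ[ℤ] b) ⊗ₜ[ℤ] n) = ψ ((a ⊗ₜ[ℤ] b) ⊗ₜ[ℤ] n)) : φ = ψ := by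
  have : φ.toIntLinearMap = ψ.toIntLinearMap := by
    apply TensorProduct.ext_threefold
    exact h
  ext x
  exact DFunLike.congr_fun this x

/-- `H : A ⊗ M → A ⊗ A ⊗ Mₑₑ`: the homomorphism induced by the diagonal `A → A ⊕ A`. -/
def QTensor.H : QTensor M A →+ SqTensor M A :=
  QTensor.lift M (fun a m => (a ⊗ₜ[ℤ] a) ⊗ₜ[ℤ] M.H m)
    (fun a b n => (a ⊗ₜ[ℤ] b) ⊗ₜ[ℤ] n + (b ⊗ₜ[ℤ] a) ⊗ₜ[ℤ] (M.H (M.P n) - n))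
    (fun _ _ _ => by rw [map_add, TensorProduct.tmul_add])
    (fun _ _ _ _ => by
      simp only [TensorProduct.add_tmul, TensorProduct.tmul_add]; abel)
    (fun _ _ _ _ => by
      simp only [TensorProduct.add_tmul, TensorProduct.tmul_add]; abel)
    (fun _ _ _ _ => by
      simp only [map_add, TensorProduct.tmul_add, TensorProduct.tmul_sub]; abel)
    (fun _ _ _ => by
      simp only [M.HPH, two_smul, TensorProduct.add_tmul, TensorProduct.tmul_add,
        add_sub_cancel_right]; abel)
    (fun _ _ => by rw [← TensorProduct.tmul_add, add_sub_cancel])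

/-- `P : A ⊗ A ⊗ Mₑₑ → A ⊗ M`, `a ⊗ b ⊗ n ↦ [a, b] ⊗ n`: the homomorphism induced by the folding
map `A ⊕ A → A`. -/
def QTensor.P : SqTensor M A →+ QTensor M A :=
  TensorProduct.liftAddHom
    (TensorProduct.liftAddHom
      (AddMonoidHom.mk' (fun a => AddMonoidHom.mk' (fun b =>
          AddMonoidHom.mk' (fun n => tmulEE M a b n) (fun _ _ => tmulEE_add M _ _ _ _))
          (fun _ _ => by ext; exact tmulEE_add_right M _ _ _ _))
        (fun _ _ => by ext; exact tmulEE_add_left M _ _ _ _))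
      (fun r a b => by
        ext n
        have h1 : ∀ b n, tmulEE M (r • a) b n = r • tmulEE M a b n := fun b n =>
          map_zsmul (AddMonoidHom.mk' (fun a => tmulEE M a b n)
            (fun _ _ => tmulEE_add_left M _ _ _ _)) r a
        have h2 : ∀ n, tmulEE M a (r • b) n = r • tmulEE M a b n := fun n =>
          map_zsmul (AddMonoidHom.mk' (fun b => tmulEE M a b n)
            (fun _ _ => tmulEE_add_right M _ _ _ _)) r b
        exact (h1 b n).trans (h2 n).symm))
    (fun r x n => by simp)

@[simp] lemma QTensor.H_tmulE (a : A) (m : M.e) :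
    QTensor.H M (tmulE M a m) = (a ⊗ₜ[ℤ] a) ⊗ₜ[ℤ] M.H m := by simp [QTensor.H]

@[simp] lemma QTensor.H_tmulEE (a b : A) (n : M.ee) :
    QTensor.H M (tmulEE M a b n) =
      (a ⊗ₜ[ℤ] b) ⊗ₜ[ℤ] n + (b ⊗ₜ[ℤ] a) ⊗ₜ[ℤ] (M.H (M.P n) - n) := by simp [QTensor.H]

@[simp] lemma QTensor.P_tmul (a b : A) (n : M.ee) :
    QTensor.P M ((a ⊗ₜ[ℤ] b) ⊗ₜ[ℤ] n) = tmulEE M a b n := rfl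

lemma tmulEE_swap (a b : A) (n : M.ee) :
    tmulEE M b a (M.H (M.P n) - n) = tmulEE M a b n := by
  have key : ∀ (a b : A) (n : M.ee),
      tmulEE M a b n + tmulEE M b a n = tmulEE M a b (M.H (M.P n)) := fun a b n => by
    have h := tmulEE_self M (a + b) n
    rw [add_tmulE, tmulEE_add_left, tmulEE_add_right, tmulEE_add_right, tmulEE_self,
      tmulEE_self] at h
    have h' : (tmulE M a (M.P n) + tmulE M b (M.P n)) + (tmulEE M a b n + tmulEE M b a n) =
        (tmulE M a (M.P n) + tmulE M b (M.P n)) + tmulEE M a b (M.H (M.P n)) := by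
      rw [← h]; abel
    exact add_left_cancel h'
  have h := key b a n
  have h2 : tmulEE M b a (M.H (M.P n)) =
      tmulEE M b a (M.H (M.P n) - n) + tmulEE M b a n := by
    rw [← tmulEE_add, sub_add_cancel]
  rw [h2, add_comm] at h
  exact (add_right_cancel h).symm

lemma QTensor.H_map (f : A →+ A') :
    (QTensor.H M).comp (QTensor.map M f) = (SqTensor.map M f f).comp (QTensor.H M) := by
  apply QTensor.hom_ext <;> intros <;> simp

lemma QTensor.P_map (f : A →+ A') :
    (QTensor.P M).comp (SqTensor.map M f f) = (QTensor.map M f).comp (QTensor.P M) := by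
  apply SqTensor.hom_ext
  intros; simp

/-- `(f + g) ⊗ M = f ⊗ M + P (g ⊗ f) H + g ⊗ M`. -/
lemma QTensor.map_add (f g : A →+ A') (x : QTensor M A) :
    QTensor.map M (f + g) x =
      QTensor.map M f x + QTensor.P M (SqTensor.map M g f (QTensor.H M x)) +
        QTensor.map M g x := by
  have : QTensor.map M (f + g) =
      QTensor.map M f + (QTensor.P M).comp ((SqTensor.map M g f).comp (QTensor.H M)) +
        QTensor.map M g := by
    apply QTensor.hom_ext
    · intro a m
      simp only [map_tmulE, AddMonoidHom.add_apply, AddMonoidHom.comp_apply, H_tmulE,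
        SqTensor.map_tmul, P_tmul]
      rw [add_comm (f a), add_tmulE]
      abel
    · intro a b n
      simp only [map_tmulEE, AddMonoidHom.add_apply, AddMonoidHom.comp_apply, H_tmulEE,
        _root_.map_add, SqTensor.map_tmul, P_tmul]
      rw [tmulEE_swap, tmulEE_add_left, tmulEE_add_right, tmulEE_add_right]
      abel
  exact DFunLike.congr_fun this x

end Tensor

/-! ### Functors on abelian groups and simplicial abelian groups -/

/-- The functor `A ↦ A ⊗ M`. -/
def tensorFunctor : AddCommGrpCat.{u} ⥤ AddCommGrpCat.{u} where
  obj A := AddCommGrpCat.of (QTensor M A)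
  map f := AddCommGrpCat.ofHom (QTensor.map M f.hom)
  map_id A := by
    ext1
    apply QTensor.hom_ext <;> intros <;> simp
  map_comp f g := by
    ext1
    apply QTensor.hom_ext <;> intros <;> simp

/-- The functor `A ↦ A ⊗ A ⊗ Mₑₑ`. -/
def sqFunctor : AddCommGrpCat.{u} ⥤ AddCommGrpCat.{u} where
  obj A := AddCommGrpCat.of (SqTensor M A)
  map f := AddCommGrpCat.ofHom (SqTensor.map M f.hom f.hom)
  map_id A := by
    ext1
    apply SqTensor.hom_ext
    intros; simp
  map_comp f g := by
    ext1
    apply SqTensor.hom_ext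
    intros; simp

/-- The natural transformation `H : A ⊗ M → A ⊗ A ⊗ Mₑₑ`. -/
def natH : tensorFunctor M ⟶ sqFunctor M where
  app A := AddCommGrpCat.ofHom (QTensor.H M)
  naturality A A' f := by
    ext1
    exact QTensor.H_map M f.hom

/-- The natural transformation `P : A ⊗ A ⊗ Mₑₑ → A ⊗ M`. -/
def natP : sqFunctor M ⟶ tensorFunctor M where
  app A := AddCommGrpCat.ofHom (QTensor.P M)
  naturality A A' f := by
    ext1
    exact QTensor.P_map M f.hom

/-- For simplicial abelian groups `X`, `X'` and simplicial maps `f g : X ⟶ X'`, the simplicial map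
`f ⊗ g ⊗ Mₑₑ : X ⊗ X ⊗ Mₑₑ ⟶ X' ⊗ X' ⊗ Mₑₑ`. -/
def simplicialSq {X X' : SimplicialObject AddCommGrpCat.{u}} (f g : X ⟶ X') :
    ((SimplicialObject.whiskering _ _).obj (sqFunctor M)).obj X ⟶
      ((SimplicialObject.whiskering _ _).obj (sqFunctor M)).obj X' where
  app k := AddCommGrpCat.ofHom (SqTensor.map M (f.app k).hom (g.app k).hom)
  naturality k l i := by
    ext1
    apply SqTensor.hom_ext
    intro a b n
    have hf := ConcreteCategory.congr_hom (f.naturality i) a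
    have hg := ConcreteCategory.congr_hom (g.naturality i) b
    simp only [ConcreteCategory.comp_apply] at hf hg
    change ((f.app l) ((X.map i) a) ⊗ₜ[ℤ] (g.app l) ((X.map i) b)) ⊗ₜ[ℤ] n =
      ((X'.map i) ((f.app k) a) ⊗ₜ[ℤ] (X'.map i) ((g.app k) b)) ⊗ₜ[ℤ] n
    rw [hf, hg]

/-! ### Chain complexes -/

/-- Chain complexes of abelian groups, graded by `ℤ`. -/
abbrev Cx := ChainComplex AddCommGrpCat.{u} ℤ

/-- The inclusion of non-negative degrees into all degrees. -/
def natEmb : ComplexShape.Embedding (ComplexShape.down ℕ) (ComplexShape.down ℤ) :=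
  ComplexShape.Embedding.mk' _ _ (fun n => (n : ℤ)) Nat.cast_injective
    (by intro i j; simp only [ComplexShape.down_Rel]; omega)

instance : natEmb.IsRelIff := by unfold natEmb; infer_instance

/-- The inverse `N⁻¹` of the Dold-Kan normalization, on (the part in degrees `≥ 0` of) a chain
complex. It is only ever used for chain complexes that vanish in negative degrees. -/
noncomputable def Ninv : Cx.{u} ⥤ SimplicialObject AddCommGrpCat.{u} :=
  natEmb.restrictionFunctor _ ⋙ Abelian.DoldKan.Γ

/-- The normalization: the Moore complex of a simplicial abelian group. -/
noncomputable def Nor : SimplicialObject AddCommGrpCat.{u} ⥤ Cx.{u} :=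
  Abelian.DoldKan.N ⋙ natEmb.extendFunctor _

/-- The functor `M_#`, `M_# Y = N ((N⁻¹ Y) ⊗ M)`. -/
noncomputable def sharp : Cx.{u} ⥤ Cx.{u} :=
  Ninv ⋙ (SimplicialObject.whiskering _ _).obj (tensorFunctor M) ⋙ Nor

/-- The chain complex `M_# (Y | Y) = N ((N⁻¹ Y) ⊗ (N⁻¹ Y) ⊗ Mₑₑ)`. -/
noncomputable def sharpSq (Y : Cx.{u}) : Cx.{u} :=
  Nor.obj (((SimplicialObject.whiskering _ _).obj (sqFunctor M)).obj (Ninv.obj Y))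

/-- The chain map `H : M_# Y ⟶ M_# (Y | Y)`. -/
noncomputable def sharpH (Y : Cx.{u}) : (sharp M).obj Y ⟶ sharpSq M Y :=
  Nor.map (((SimplicialObject.whiskering _ _).map (natH M)).app (Ninv.obj Y))

/-- The chain map `P : M_# (Y | Y) ⟶ M_# Y`. -/
noncomputable def sharpP (Y : Cx.{u}) : sharpSq M Y ⟶ (sharp M).obj Y :=
  Nor.map (((SimplicialObject.whiskering _ _).map (natP M)).app (Ninv.obj Y))

/-- The chain map `f ⊗ g : M_# (Y | Y) ⟶ M_# (Y' | Y')` induced by `f g : Y ⟶ Y'`. -/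
noncomputable def sharpSqMap {Y Y' : Cx.{u}} (f g : Y ⟶ Y') : sharpSq M Y ⟶ sharpSq M Y' :=
  Nor.map (simplicialSq M (Ninv.map f) (Ninv.map g))

/-- The chain map `M_# f + P (g ⊗ f) H + M_# g`. -/
noncomputable def sharpAdd {Y Y' : Cx.{u}} (f g : Y ⟶ Y') :
    (sharp M).obj Y ⟶ (sharp M).obj Y' :=
  (sharp M).map f + sharpH M Y ≫ sharpSqMap M g f ≫ sharpP M Y' + (sharp M).map g

instance : (Abelian.DoldKan.N (A := AddCommGrpCat.{u})).Additive where
  map_add {X Y f g} := by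
    apply HomologicalComplex.hom_ext
    intro n
    rw [HomologicalComplex.add_f_apply]
    have key (h : X ⟶ Y) :
        (Abelian.DoldKan.N.map h).f n ≫ (AlgebraicTopology.NormalizedMooreComplex.objX Y n).arrow =
          (AlgebraicTopology.NormalizedMooreComplex.objX X n).arrow ≫
            h.app (Opposite.op (SimplexCategory.mk n)) := by
      simp [Abelian.DoldKan.N]
      exact Subobject.factorThru_arrow _ _ _
    apply (cancel_mono (AlgebraicTopology.NormalizedMooreComplex.objX Y n).arrow).1
    refine (key (f + g)).trans ?_
    refine Eq.trans ?_ (Preadditive.add_comp _ _ _ _ _ _).symm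
    exact (Preadditive.comp_add _ _ _ _ _ _).trans
      (congrArg₂ (· + ·) (key f).symm (key g).symm)

instance : Ninv.{u}.Additive := by
  have : (Abelian.DoldKan.equivalence (A := AddCommGrpCat.{u})).functor.Additive :=
    inferInstanceAs (Abelian.DoldKan.N (A := AddCommGrpCat.{u})).Additive
  have : (Abelian.DoldKan.Γ (A := AddCommGrpCat.{u})).Additive :=
    Equivalence.inverse_additive Abelian.DoldKan.equivalence
  unfold Ninv
  infer_instance

instance : Nor.{u}.Additive := by
  unfold Nor
  infer_instance

/-- Since `⊗ M` is quadratic, `M_# (f + g) = M_# f + P (g ⊗ f) H + M_# g`. -/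
lemma sharp_map_add {Y Y' : Cx.{u}} (f g : Y ⟶ Y') :
    (sharp M).map (f + g) = sharpAdd M f g := by
  have h : ((SimplicialObject.whiskering _ _).obj (tensorFunctor M)).map (Ninv.map (f + g)) =
      ((SimplicialObject.whiskering _ _).obj (tensorFunctor M)).map (Ninv.map f) +
      (((SimplicialObject.whiskering _ _).map (natH M)).app (Ninv.obj Y) ≫
        simplicialSq M (Ninv.map g) (Ninv.map f) ≫
        ((SimplicialObject.whiskering _ _).map (natP M)).app (Ninv.obj Y')) +
      ((SimplicialObject.whiskering _ _).obj (tensorFunctor M)).map (Ninv.map g) := by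
    rw [Ninv.map_add]
    ext k x
    exact QTensor.map_add M ((Ninv.map f).app k).hom ((Ninv.map g).app k).hom x
  dsimp only [sharp, Functor.comp_map]
  rw [h, Nor.map_add, Nor.map_add]
  simp only [Functor.map_comp]
  rfl

/-! ### Moore complexes, pseudo-homology -/

/-- The free abelian group on the set of non-zero elements of `A`. (The zero element is left out
so that the resolution of the trivial group is trivial.) -/
abbrev FreeNZ (A : Type u) [AddCommGroup A] : Type u := FreeAbelianGroup {a : A // a ≠ 0}

section FreeNZ

variable {A A' A'' : Type u} [AddCommGroup A] [AddCommGroup A'] [AddCommGroup A'']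

open Classical in
/-- The element of `FreeNZ A` given by `a`: a generator if `a ≠ 0`, and zero if `a = 0`. -/
noncomputable def FreeNZ.gen (a : A) : FreeNZ A :=
  if h : a = 0 then 0 else FreeAbelianGroup.of ⟨a, h⟩

/-- The projection `FreeNZ A → A`. -/
def FreeNZ.proj (A : Type u) [AddCommGroup A] : FreeNZ A →+ A :=
  FreeAbelianGroup.lift Subtype.val

lemma FreeNZ.proj_gen (a : A) : FreeNZ.proj A (FreeNZ.gen a) = a := by
  unfold FreeNZ.gen
  split_ifs with h
  · simp [h]
  · simp [FreeNZ.proj]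

/-- The homomorphism `FreeNZ A → FreeNZ A'` induced by `φ : A → A'`. -/
noncomputable def FreeNZ.map (φ : A →+ A') : FreeNZ A →+ FreeNZ A' :=
  FreeAbelianGroup.lift fun a => FreeNZ.gen (φ a.1)

lemma FreeNZ.map_of (φ : A →+ A') (a : {a : A // a ≠ 0}) :
    FreeNZ.map φ (FreeAbelianGroup.of a) = FreeNZ.gen (φ a.1) := by
  simp [FreeNZ.map]

lemma FreeNZ.map_gen (φ : A →+ A') (a : A) :
    FreeNZ.map φ (FreeNZ.gen a) = FreeNZ.gen (φ a) := by
  by_cases h : a = 0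
  · simp [FreeNZ.gen, h]
  · rw [FreeNZ.gen, dif_neg h, FreeNZ.map_of]

lemma FreeNZ.map_id : FreeNZ.map (AddMonoidHom.id A) = AddMonoidHom.id _ := by
  apply FreeAbelianGroup.lift_ext
  rintro ⟨a, h⟩
  rw [FreeNZ.map_of]
  simp [FreeNZ.gen, h]

lemma FreeNZ.map_comp (ψ : A' →+ A'') (φ : A →+ A') :
    FreeNZ.map (ψ.comp φ) = (FreeNZ.map ψ).comp (FreeNZ.map φ) := by
  apply FreeAbelianGroup.lift_ext
  intro a
  change _ = FreeNZ.map ψ (FreeNZ.map φ (FreeAbelianGroup.of a))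
  rw [FreeNZ.map_of, FreeNZ.map_of, FreeNZ.map_gen]
  rfl

lemma FreeNZ.proj_map (φ : A →+ A') :
    (FreeNZ.proj A').comp (FreeNZ.map φ) = φ.comp (FreeNZ.proj A) := by
  apply FreeAbelianGroup.lift_ext
  intro a
  rw [AddMonoidHom.comp_apply, FreeNZ.map_of, FreeNZ.proj_gen]
  simp [FreeNZ.proj]

end FreeNZ

/-- The free abelian group on the set of non-zero elements of `A`. -/
abbrev resF (A : AddCommGrpCat.{u}) : AddCommGrpCat.{u} := AddCommGrpCat.of (FreeNZ A)

/-- The projection of `resF A` onto `A`. -/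
abbrev resε (A : AddCommGrpCat.{u}) : resF A ⟶ A := AddCommGrpCat.ofHom (FreeNZ.proj A)

/-- The relation group of `A`; `0 → resK A → resF A → A → 0` is a short free resolution. -/
noncomputable abbrev resK (A : AddCommGrpCat.{u}) : AddCommGrpCat.{u} := kernel (resε A)

/-- The homomorphism `d_A : resK A → resF A`. -/
noncomputable abbrev resd (A : AddCommGrpCat.{u}) : resK A ⟶ resF A := kernel.ι (resε A)

/-- The homomorphism of free groups induced by `φ`. -/
noncomputable def resFMap {A A' : AddCommGrpCat.{u}} (φ : A ⟶ A') : resF A ⟶ resF A' :=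
  AddCommGrpCat.ofHom (FreeNZ.map φ.hom)

lemma resFMap_ε {A A' : AddCommGrpCat.{u}} (φ : A ⟶ A') :
    resFMap φ ≫ resε A' = resε A ≫ φ := by
  ext1
  exact FreeNZ.proj_map φ.hom

/-- The homomorphism of relation groups induced by `φ`. -/
noncomputable def resKMap {A A' : AddCommGrpCat.{u}} (φ : A ⟶ A') : resK A ⟶ resK A' :=
  kernel.map _ _ (resFMap φ) φ (resFMap_ε φ).symm

lemma resKMap_d {A A' : AddCommGrpCat.{u}} (φ : A ⟶ A') :
    resKMap φ ≫ resd A' = resd A ≫ resFMap φ := by simp [resKMap, kernel.map]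

lemma resFMap_id (A : AddCommGrpCat.{u}) : resFMap (𝟙 A) = 𝟙 (resF A) := by
  ext1
  exact FreeNZ.map_id

lemma resFMap_comp {A A' A'' : AddCommGrpCat.{u}} (φ : A ⟶ A') (ψ : A' ⟶ A'') :
    resFMap (φ ≫ ψ) = resFMap φ ≫ resFMap ψ := by
  ext1
  exact FreeNZ.map_comp _ _

lemma resKMap_id (A : AddCommGrpCat.{u}) : resKMap (𝟙 A) = 𝟙 (resK A) := by
  rw [← cancel_mono (resd A), resKMap_d, resFMap_id, Category.comp_id, Category.id_comp]

lemma resKMap_comp {A A' A'' : AddCommGrpCat.{u}} (φ : A ⟶ A') (ψ : A' ⟶ A'') :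
    resKMap (φ ≫ ψ) = resKMap φ ≫ resKMap ψ := by
  rw [← cancel_mono (resd A''), resKMap_d, resFMap_comp, Category.assoc, resKMap_d,
    reassoc_of% (resKMap_d φ)]

lemma down_rel (n : ℤ) : (ComplexShape.down ℤ).Rel (n + 1) n := rfl

/-- The Moore chain complex `C(A, n)`: the short free resolution of `A`, with the free group in
degree `n` and the relation group in degree `n + 1`. -/
noncomputable def moore (A : AddCommGrpCat.{u}) (n : ℤ) : Cx.{u} :=
  HomologicalComplex.double (resd A) (down_rel n)

/-- The isomorphism of `C(A, n)` in degree `n + 1` with the relation group. -/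
noncomputable def mooreX₀ (A : AddCommGrpCat.{u}) (n : ℤ) : (moore A n).X (n + 1) ≅ resK A :=
  HomologicalComplex.doubleXIso₀ (resd A) (down_rel n)

/-- The isomorphism of `C(A, n)` in degree `n` with the free group. -/
noncomputable def mooreX₁ (A : AddCommGrpCat.{u}) (n : ℤ) : (moore A n).X n ≅ resF A :=
  HomologicalComplex.doubleXIso₁ (resd A) (down_rel n) (by omega)

lemma moore_d (A : AddCommGrpCat.{u}) (n : ℤ) :
    (moore A n).d (n + 1) n = (mooreX₀ A n).hom ≫ resd A ≫ (mooreX₁ A n).inv :=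
  HomologicalComplex.double_d _ _ (by omega)

lemma moore_d' (A : AddCommGrpCat.{u}) (n : ℤ) : (moore A n).d n (n - 1) = 0 :=
  HomologicalComplex.double_d_eq_zero₀ _ _ _ _ (by omega)

/-- Chain maps out of `C(A, n)`. -/
noncomputable def mooreDesc {A : AddCommGrpCat.{u}} {n : ℤ} {Z : Cx.{u}}
    (k : resK A ⟶ Z.X (n + 1)) (f : resF A ⟶ Z.X n) (h : k ≫ Z.d (n + 1) n = resd A ≫ f)
    (hf : f ≫ Z.d n (n - 1) = 0) : moore A n ⟶ Z :=
  HomologicalComplex.mkHomFromDouble (down_rel n) (by omega) k f h (by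
    intro j hj
    obtain rfl : j = n - 1 := by simp only [ComplexShape.down_Rel] at hj; omega
    exact hf)

/-- The chain map `C(φ, n)`. -/
noncomputable def mooreMap {A A' : AddCommGrpCat.{u}} (φ : A ⟶ A') (n : ℤ) :
    moore A n ⟶ moore A' n :=
  mooreDesc (resKMap φ ≫ (mooreX₀ A' n).inv) (resFMap φ ≫ (mooreX₁ A' n).inv)
    (by rw [moore_d, Category.assoc, Iso.inv_hom_id_assoc, reassoc_of% (resKMap_d φ)])
    (by rw [moore_d', comp_zero])

lemma mooreDesc_f₀ {A : AddCommGrpCat.{u}} {n : ℤ} {Z : Cx.{u}}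
    (k : resK A ⟶ Z.X (n + 1)) (f : resF A ⟶ Z.X n) (h hf) :
    (mooreDesc k f h hf).f (n + 1) =
      (mooreX₀ A n).hom ≫ k :=
  HomologicalComplex.mkHomFromDouble_f₀ ..

lemma mooreDesc_f₁ {A : AddCommGrpCat.{u}} {n : ℤ} {Z : Cx.{u}}
    (k : resK A ⟶ Z.X (n + 1)) (f : resF A ⟶ Z.X n) (h hf) :
    (mooreDesc k f h hf).f n =
      (mooreX₁ A n).hom ≫ f :=
  HomologicalComplex.mkHomFromDouble_f₁ ..

lemma moore_hom_ext {A : AddCommGrpCat.{u}} {n : ℤ} {Z : Cx.{u}} {f g : moore A n ⟶ Z}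
    (h₀ : (mooreX₀ A n).inv ≫ f.f (n + 1) =
      (mooreX₀ A n).inv ≫ g.f (n + 1))
    (h₁ : (mooreX₁ A n).inv ≫ f.f n =
      (mooreX₁ A n).inv ≫ g.f n) : f = g :=
  HomologicalComplex.from_double_hom_ext ((cancel_epi (mooreX₀ A n).inv).1 h₀)
    ((cancel_epi (mooreX₁ A n).inv).1 h₁)

lemma mooreDesc_comp {A : AddCommGrpCat.{u}} {n : ℤ} {Z Z' : Cx.{u}}
    (k : resK A ⟶ Z.X (n + 1)) (f : resF A ⟶ Z.X n) (h hf) (Φ : Z ⟶ Z') :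
    mooreDesc k f h hf ≫ Φ = mooreDesc (k ≫ Φ.f (n + 1)) (f ≫ Φ.f n)
      (by rw [Category.assoc, Φ.comm, reassoc_of% h])
      (by rw [Category.assoc, Φ.comm, reassoc_of% hf, zero_comp]) := by
  apply moore_hom_ext <;> simp [mooreDesc_f₀, mooreDesc_f₁]

lemma mooreMap_desc {A A' : AddCommGrpCat.{u}} (φ : A ⟶ A') {n : ℤ} {Z : Cx.{u}}
    (k : resK A' ⟶ Z.X (n + 1)) (f : resF A' ⟶ Z.X n) (h hf) :
    mooreMap φ n ≫ mooreDesc k f h hf = mooreDesc (resKMap φ ≫ k) (resFMap φ ≫ f)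
      (by rw [Category.assoc, h, reassoc_of% (resKMap_d φ)])
      (by rw [Category.assoc, hf, comp_zero]) := by
  apply moore_hom_ext <;> simp [mooreMap, mooreDesc_f₀, mooreDesc_f₁]

/-- The functor `A ↦ C(A, n)`. -/
noncomputable def mooreFunctor (n : ℤ) : AddCommGrpCat.{u} ⥤ Cx.{u} where
  obj A := moore A n
  map φ := mooreMap φ n
  map_id A := by
    apply moore_hom_ext <;> simp [mooreMap, mooreDesc_f₀, mooreDesc_f₁, resKMap_id, resFMap_id]
  map_comp φ ψ := by
    apply moore_hom_ext <;>
      simp [mooreMap, mooreDesc_f₀, mooreDesc_f₁, resKMap_comp, resFMap_comp]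

/-- The canonical homomorphism (in fact an isomorphism) `H_n C(A, n) → A`. -/
noncomputable def mooreAug (A : AddCommGrpCat.{u}) (n : ℤ) : (moore A n).homology n ⟶ A :=
  HomologicalComplex.homologyMap
    (mooreDesc (Z := (HomologicalComplex.single _ (ComplexShape.down ℤ) n).obj A) 0
      (resε A ≫ (HomologicalComplex.singleObjXSelf _ n A).inv)
      (by rw [zero_comp, kernel.condition_assoc, zero_comp]) (by simp)) n ≫
  (HomologicalComplex.singleObjHomologySelfIso _ n A).hom

/-- The pseudo-homology `H_n(A, Z) = [C(A, n), Z]`: homotopy classes of chain maps. -/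
noncomputable abbrev PseudoHomology (n : ℤ) (A : AddCommGrpCat.{u}) (Z : Cx.{u}) : Type u :=
  (HomotopyCategory.quotient _ _).obj (moore A n) ⟶ (HomotopyCategory.quotient _ _).obj Z

/-- `H_n(A, Φ)`, for a chain map `Φ`. -/
noncomputable def PseudoHomology.push (n : ℤ) (A : AddCommGrpCat.{u}) {Z Z' : Cx.{u}}
    (Φ : Z ⟶ Z') : PseudoHomology n A Z →+ PseudoHomology n A Z' :=
  Preadditive.rightComp _ ((HomotopyCategory.quotient _ _).map Φ)

/-- `H_n(φ, Z)`, for a homomorphism `φ`. -/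
noncomputable def PseudoHomology.pull (n : ℤ) {A A' : AddCommGrpCat.{u}} (φ : A ⟶ A')
    (Z : Cx.{u}) : PseudoHomology n A' Z →+ PseudoHomology n A Z :=
  Preadditive.leftComp _ ((HomotopyCategory.quotient _ _).map (mooreMap φ n))

@[simp] lemma PseudoHomology.push_apply (n : ℤ) (A : AddCommGrpCat.{u}) {Z Z' : Cx.{u}}
    (Φ : Z ⟶ Z') (x : PseudoHomology n A Z) :
    PseudoHomology.push n A Φ x = x ≫ (HomotopyCategory.quotient _ _).map Φ := rfl

@[simp] lemma PseudoHomology.pull_apply (n : ℤ) {A A' : AddCommGrpCat.{u}} (φ : A ⟶ A')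
    (Z : Cx.{u}) (x : PseudoHomology n A' Z) :
    PseudoHomology.pull n φ Z x = (HomotopyCategory.quotient _ _).map (mooreMap φ n) ≫ x := rfl

/-- The homomorphism on `H_n` induced by a homotopy class of chain maps. -/
noncomputable def hoHomologyMap {Y Z : Cx.{u}}
    (x : (HomotopyCategory.quotient _ _).obj Y ⟶ (HomotopyCategory.quotient _ _).obj Z) (n : ℤ) :
    Y.homology n ⟶ Z.homology n :=
  HomologicalComplex.homologyMap ((HomotopyCategory.quotient _ _).preimage x) n

@[simp] lemma hoHomologyMap_quotient {Y Z : Cx.{u}} (f : Y ⟶ Z) (n : ℤ) :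
    hoHomologyMap ((HomotopyCategory.quotient _ _).map f) n =
      HomologicalComplex.homologyMap f n :=
  (HomotopyCategory.homotopyOfEq _ _
    ((HomotopyCategory.quotient _ _).map_preimage _)).homologyMap_eq n

/-- The map `μ : H_n(A, Z) → Hom(H_n C(A, n), H_n Z) ≅ Hom(A, H_n Z)`; the last identification is
by `mooreAug`. -/
noncomputable def PseudoHomology.mu (n : ℤ) (A : AddCommGrpCat.{u}) (Z : Cx.{u}) :
    PseudoHomology n A Z →+ ((moore A n).homology n ⟶ Z.homology n) :=
  AddMonoidHom.mk' (fun x => hoHomologyMap x n) (by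
    intro x y
    obtain ⟨f, rfl⟩ := (HomotopyCategory.quotient _ _).map_surjective x
    obtain ⟨g, rfl⟩ := (HomotopyCategory.quotient _ _).map_surjective y
    rw [← Functor.map_add]
    simp only [hoHomologyMap_quotient, HomologicalComplex.homologyMap_add])

lemma PseudoHomology.mu_quotient {n : ℤ} {A : AddCommGrpCat.{u}} {Z : Cx.{u}}
    (f : moore A n ⟶ Z) :
    PseudoHomology.mu n A Z ((HomotopyCategory.quotient _ _).map f) =
      HomologicalComplex.homologyMap f n := hoHomologyMap_quotient f n

/-- The chain map `C(A, n) ⟶ Z` given by a homomorphism from the relation group of `A` to the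
cycles of `Z` in degree `n + 1` (and zero in degree `n`). -/
noncomputable def deltaChain {n : ℤ} {A : AddCommGrpCat.{u}} {Z : Cx.{u}}
    (z : resK A ⟶ Z.cycles (n + 1)) : moore A n ⟶ Z :=
  mooreDesc (z ≫ Z.iCycles (n + 1)) 0 (by simp) (by simp)

/-- The subgroup `im (Δ b_*)` of `H_n(A, Z)`, where `b : D → H_{n+1} Z` and
`Ext(A, D) --b_*--> Ext(A, H_{n+1} Z) --Δ--> H_n(A, Z)`.
In terms of the short free resolution `K → F` of `A`, elements of `Ext(A, D)` are represented by
homomorphisms `g : K → D`, and `Δ (b_* g)` is the homotopy class of the chain map which is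
in degree `n + 1` any lift `z` of `b ∘ g : K → H_{n+1} Z` to the cycles of `Z`, and is zero in
degree `n`. -/
noncomputable def deltaIm (n : ℤ) (A : AddCommGrpCat.{u}) (Z : Cx.{u}) {D : AddCommGrpCat.{u}}
    (b : D ⟶ Z.homology (n + 1)) : AddSubgroup (PseudoHomology n A Z) where
  carrier := {x | ∃ (g : resK A ⟶ D) (z : resK A ⟶ Z.cycles (n + 1)),
    z ≫ Z.homologyπ (n + 1) = g ≫ b ∧ x = (HomotopyCategory.quotient _ _).map (deltaChain z)}
  zero_mem' := ⟨0, 0, by simp, by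
    rw [show deltaChain (0 : resK A ⟶ Z.cycles (n + 1)) = 0 by
      apply moore_hom_ext <;> simp [deltaChain, mooreDesc_f₀, mooreDesc_f₁], Functor.map_zero]⟩
  add_mem' := by
    rintro _ _ ⟨g, z, h, rfl⟩ ⟨g', z', h', rfl⟩
    refine ⟨g + g', z + z', by simp [h, h'], ?_⟩
    rw [← Functor.map_add]
    congr 1
    apply moore_hom_ext <;> simp [deltaChain, mooreDesc_f₀, mooreDesc_f₁]
  neg_mem' := by
    rintro _ ⟨g, z, h, rfl⟩
    refine ⟨-g, -z, by simp [h], ?_⟩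
    rw [← Functor.map_neg]
    congr 1
    apply moore_hom_ext <;> simp [deltaChain, mooreDesc_f₀, mooreDesc_f₁]

lemma deltaIm_le_mu_ker (n : ℤ) (A : AddCommGrpCat.{u}) (Z : Cx.{u}) {D : AddCommGrpCat.{u}}
    (b : D ⟶ Z.homology (n + 1)) : deltaIm n A Z b ≤ (PseudoHomology.mu n A Z).ker := by
  rintro _ ⟨g, z, h, rfl⟩
  rw [AddMonoidHom.mem_ker, PseudoHomology.mu_quotient]
  rw [← cancel_epi ((moore A n).homologyπ n), HomologicalComplex.homologyπ_naturality, comp_zero]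
  have h0 : HomologicalComplex.cyclesMap (deltaChain z) n = 0 := by
    rw [← cancel_mono (Z.iCycles n), HomologicalComplex.cyclesMap_i, deltaChain, mooreDesc_f₁,
      comp_zero, comp_zero, zero_comp]
  rw [h0, zero_comp]

lemma deltaIm_push (n : ℤ) (A : AddCommGrpCat.{u}) {Z Z' : Cx.{u}} {D D' : AddCommGrpCat.{u}}
    (b : D ⟶ Z.homology (n + 1)) (b' : D' ⟶ Z'.homology (n + 1)) (φ : D ⟶ D') (Φ : Z ⟶ Z')
    (h : b ≫ HomologicalComplex.homologyMap Φ (n + 1) = φ ≫ b') :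
    deltaIm n A Z b ≤ (deltaIm n A Z' b').comap (PseudoHomology.push n A Φ) := by
  rintro _ ⟨g, z, hz, rfl⟩
  refine ⟨g ≫ φ, z ≫ HomologicalComplex.cyclesMap Φ _, ?_, ?_⟩
  · rw [Category.assoc, ← HomologicalComplex.homologyπ_naturality, reassoc_of% hz, h,
      Category.assoc]
  · rw [PseudoHomology.push_apply, ← Functor.map_comp]
    congr 1
    apply moore_hom_ext <;> simp [deltaChain, mooreDesc_f₀, mooreDesc_f₁]

lemma deltaIm_pull (n : ℤ) {A A' : AddCommGrpCat.{u}} (φ : A ⟶ A') (Z : Cx.{u})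
    {D : AddCommGrpCat.{u}} (b : D ⟶ Z.homology (n + 1)) :
    deltaIm n A' Z b ≤ (deltaIm n A Z b).comap (PseudoHomology.pull n φ Z) := by
  rintro _ ⟨g, z, hz, rfl⟩
  refine ⟨resKMap φ ≫ g, resKMap φ ≫ z, by simp [hz], ?_⟩
  rw [PseudoHomology.pull_apply, ← Functor.map_comp]
  congr 1
  rw [deltaChain, deltaChain, mooreMap_desc]
  congr 1

/-! ### Boundary invariants -/

/-- Boundary invariants `(b, β)` for a graded abelian group `B` and a chain complex `Z`.
The index is shifted by one: `b n` is the homomorphism `b_{n+1} : B_{n+1} → H_n Z`, and `β n` is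
`β_{n+1} ∈ H_n(B_{n+1}, Z) / im (Δ (b_{n+2})_*)`, with `μ β_{n+1} = b_{n+1}`. -/
structure Boundary (B : GradedObject ℤ AddCommGrpCat.{u}) (Z : Cx.{u}) where
  b (n : ℤ) : B (n + 1) ⟶ Z.homology n
  β (n : ℤ) : PseudoHomology n (B (n + 1)) Z ⧸ deltaIm n (B (n + 1)) Z (b (n + 1))
  mu_β (n : ℤ) : QuotientAddGroup.lift _ (PseudoHomology.mu n (B (n + 1)) Z)
    (deltaIm_le_mu_ker n (B (n + 1)) Z (b (n + 1))) (β n) = mooreAug (B (n + 1)) n ≫ b n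

/-- Compatibility of boundary invariants with a homomorphism `φ : B → B'` of graded abelian groups
and a chain map `Φ : Z → Z'`: the squares `Φ_* b = b' φ` commute, and
`Φ_* β_{n+1} = φ^* β'_{n+1}` in `H_n(B_{n+1}, Z') / im (Δ (b'_{n+2})_*)`. -/
def Boundary.Compat {B B' : GradedObject ℤ AddCommGrpCat.{u}} {Z Z' : Cx.{u}}
    (s : Boundary B Z) (s' : Boundary B' Z') (φ : B ⟶ B') (Φ : Z ⟶ Z') : Prop :=
  ∃ h : ∀ n, s.b n ≫ HomologicalComplex.homologyMap Φ n = φ (n + 1) ≫ s'.b n,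
    ∀ n, QuotientAddGroup.map _ (deltaIm n (B (n + 1)) Z' (s'.b (n + 1)))
        (PseudoHomology.push n (B (n + 1)) Φ)
        (deltaIm_push n (B (n + 1)) (s.b (n + 1)) (s'.b (n + 1)) (φ (n + 1 + 1)) Φ (h (n + 1)))
        (s.β n) =
      QuotientAddGroup.map _ (deltaIm n (B (n + 1)) Z' (s'.b (n + 1)))
        (PseudoHomology.pull n (φ (n + 1)) Z')
        (deltaIm_pull n (φ (n + 1)) Z' (s'.b (n + 1))) (s'.β n)

lemma Boundary.Compat.id {B : GradedObject ℤ AddCommGrpCat.{u}} {Z : Cx.{u}}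
    (s : Boundary B Z) : s.Compat s (𝟙 B) (𝟙 Z) := by
  refine ⟨fun n => ?_, fun n => ?_⟩
  · simp
  · obtain ⟨x, hx⟩ := QuotientAddGroup.mk_surjective (s.β n)
    rw [← hx]
    have h : mooreMap (𝟙 (B (n + 1))) n = 𝟙 _ := (mooreFunctor n).map_id _
    simp only [QuotientAddGroup.map_mk, PseudoHomology.push_apply, PseudoHomology.pull_apply]
    rw [CategoryTheory.Functor.map_id, Category.comp_id]
    congr 1
    exact (Category.id_comp _).symm.trans
      (congrArg (· ≫ x) (((HomotopyCategory.quotient _ _).map_id _).symm.trans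
        (congrArg _ h.symm)))

lemma Boundary.Compat.comp {B B' B'' : GradedObject ℤ AddCommGrpCat.{u}} {Z Z' Z'' : Cx.{u}}
    {s : Boundary B Z} {s' : Boundary B' Z'} {s'' : Boundary B'' Z''} {φ : B ⟶ B'} {Φ : Z ⟶ Z'}
    {ψ : B' ⟶ B''} {Ψ : Z' ⟶ Z''} (h : s.Compat s' φ Φ) (h' : s'.Compat s'' ψ Ψ) :
    s.Compat s'' (φ ≫ ψ) (Φ ≫ Ψ) := by
  obtain ⟨h1, h2⟩ := h
  obtain ⟨h1', h2'⟩ := h'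
  refine ⟨fun n => ?_, fun n => ?_⟩
  · rw [HomologicalComplex.homologyMap_comp, reassoc_of% (h1 n), h1' n]
    simp
  · specialize h2 n
    specialize h2' n
    obtain ⟨x, hx⟩ := QuotientAddGroup.mk_surjective (s.β n)
    obtain ⟨x', hx'⟩ := QuotientAddGroup.mk_surjective (s'.β n)
    obtain ⟨x'', hx''⟩ := QuotientAddGroup.mk_surjective (s''.β n)
    rw [← hx, ← hx'] at h2
    rw [← hx', ← hx''] at h2'
    rw [← hx, ← hx'']
    simp only [QuotientAddGroup.map_mk, PseudoHomology.push_apply, PseudoHomology.pull_apply]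
      at h2 h2' ⊢
    have e1 := congrArg (QuotientAddGroup.map _ (deltaIm n (B (n + 1)) Z'' (s''.b (n + 1)))
      (PseudoHomology.push n (B (n + 1)) Ψ)
      (deltaIm_push n (B (n + 1)) (s'.b (n + 1)) (s''.b (n + 1)) (ψ (n + 1 + 1)) Ψ
        (h1' (n + 1)))) h2
    have e2 := congrArg (QuotientAddGroup.map _ (deltaIm n (B (n + 1)) Z'' (s''.b (n + 1)))
      (PseudoHomology.pull n (φ (n + 1)) Z'')
      (deltaIm_pull n (φ (n + 1)) Z'' (s''.b (n + 1)))) h2'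
    simp only [QuotientAddGroup.map_mk, PseudoHomology.push_apply, PseudoHomology.pull_apply,
      Category.assoc] at e1 e2
    have hm : mooreMap ((φ ≫ ψ) (n + 1)) n = mooreMap (φ (n + 1)) n ≫ mooreMap (ψ (n + 1)) n :=
      (mooreFunctor n).map_comp _ _
    rw [Functor.map_comp, hm, Functor.map_comp, Category.assoc]
    exact e1.trans e2

/-! ### Quadratic bypes -/

/-- The graded homology `H_* Y`. -/
noncomputable abbrev gradedHomology (Y : Cx.{u}) : GradedObject ℤ AddCommGrpCat.{u} :=
  fun n => Y.homology n

/-- The homomorphism of graded homology groups induced by a homotopy class of chain maps. -/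
noncomputable abbrev gradedHomologyMap {Y Z : Cx.{u}}
    (x : (HomotopyCategory.quotient _ _).obj Y ⟶ (HomotopyCategory.quotient _ _).obj Z) :
    gradedHomology Y ⟶ gradedHomology Z :=
  fun n => hoHomologyMap x n

lemma gradedHomologyMap_id (Y : Cx.{u}) :
    gradedHomologyMap (𝟙 ((HomotopyCategory.quotient _ _).obj Y)) = 𝟙 (gradedHomology Y) := by
  funext n
  rw [← CategoryTheory.Functor.map_id]
  simp only [gradedHomologyMap, hoHomologyMap_quotient, HomologicalComplex.homologyMap_id]
  rfl

lemma gradedHomologyMap_comp {X Y Z : Cx.{u}}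
    (x : (HomotopyCategory.quotient _ _).obj X ⟶ (HomotopyCategory.quotient _ _).obj Y)
    (y : (HomotopyCategory.quotient _ _).obj Y ⟶ (HomotopyCategory.quotient _ _).obj Z) :
    gradedHomologyMap (x ≫ y) = gradedHomologyMap x ≫ gradedHomologyMap y := by
  funext n
  obtain ⟨f, rfl⟩ := (HomotopyCategory.quotient _ _).map_surjective x
  obtain ⟨g, rfl⟩ := (HomotopyCategory.quotient _ _).map_surjective y
  rw [← Functor.map_comp]
  simp only [gradedHomologyMap, hoHomologyMap_quotient, HomologicalComplex.homologyMap_comp]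
  simp

/-- An `r`-reduced quadratic `M`-bype `(Y, b, β)`: `Y` is an `r`-reduced chain complex of free
abelian groups, and `(b, β)` are boundary invariants for `H_* Y` and `M_# Y`. -/
structure Bype (M : QuadraticModule.{u}) (r : ℕ) where
  Y : Cx.{u}
  free (n : ℤ) : Module.Free ℤ (Y.X n)
  reduced (n : ℤ) (hn : n < r) : IsZero (Y.X n)
  bdry : Boundary (gradedHomology Y) ((sharp M).obj Y)

/-- A morphism of bypes: a homotopy class of chain maps which is compatible with the boundary
invariants. (The compatibility does not depend on the representative `f`, since `M_#` carries
homotopic chain maps to homotopic chain maps.) -/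
@[ext]
structure Bype.Hom {M : QuadraticModule.{u}} {r : ℕ} (X X' : Bype M r) where
  hom : (HomotopyCategory.quotient _ _).obj X.Y ⟶ (HomotopyCategory.quotient _ _).obj X'.Y
  compat : ∃ f : X.Y ⟶ X'.Y, (HomotopyCategory.quotient _ _).map f = hom ∧
    X.bdry.Compat X'.bdry (gradedHomologyMap hom) ((sharp M).map f)

/-- The category `bype_r(M)`. -/
instance (r : ℕ) : Category (Bype M r) where
  Hom := Bype.Hom
  id X := ⟨𝟙 _, 𝟙 _, CategoryTheory.Functor.map_id _ _, by
    rw [CategoryTheory.Functor.map_id, gradedHomologyMap_id]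
    exact Boundary.Compat.id _⟩
  comp φ ψ := ⟨φ.hom ≫ ψ.hom, by
    obtain ⟨f, hf, hf'⟩ := φ.compat
    obtain ⟨g, hg, hg'⟩ := ψ.compat
    refine ⟨f ≫ g, by rw [Functor.map_comp, hf, hg], ?_⟩
    rw [Functor.map_comp, gradedHomologyMap_comp]
    exact hf'.comp hg'⟩
  id_comp φ := Bype.Hom.ext (Category.id_comp _)
  comp_id φ := Bype.Hom.ext (Category.comp_id _)
  assoc φ ψ χ := Bype.Hom.ext (Category.assoc _ _ _)

/-- The homology functor `bype_r(M) → Ab_*`, `(Y, b, β) ↦ H_* Y`. -/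
noncomputable def Bype.homology (r : ℕ) : Bype M r ⥤ GradedObject ℤ AddCommGrpCat.{u} where
  obj X := gradedHomology X.Y
  map φ := gradedHomologyMap φ.hom
  map_id X := gradedHomologyMap_id X.Y
  map_comp φ ψ := gradedHomologyMap_comp φ.hom ψ.hom

/-! ### Homological quadratic bypes -/

/-- The functor `B ↦ C(B) = ⨁ₙ C(Bₙ, n)`. -/
noncomputable def mooreSum : GradedObject ℤ AddCommGrpCat.{u} ⥤ Cx.{u} where
  obj B := ∐ fun n => moore (B n) n
  map φ := Limits.Sigma.map fun n => mooreMap (φ n) n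
  map_id B := by
    apply Limits.Sigma.hom_ext
    intro n
    have h : mooreMap (𝟙 (B n)) n = 𝟙 _ := (mooreFunctor n).map_id _
    simp [h]
  map_comp φ ψ := by
    apply Limits.Sigma.hom_ext
    intro n
    have h : mooreMap (φ n ≫ ψ n) n = mooreMap (φ n) n ≫ mooreMap (ψ n) n :=
      (mooreFunctor n).map_comp _ _
    simp [h]

/-- An `r`-reduced homological quadratic `M`-bype `(B, b, β)`: `B` is an `r`-reduced graded abelian
group, and `(b, β)` are boundary invariants for `B` and `M_# C(B)`; here
`Sq_n(B) = H_n(M_# C(B))` and `Sq_n(A, B) = H_n(A, M_# C(B))`. -/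
structure HBype (M : QuadraticModule.{u}) (r : ℕ) where
  B : GradedObject ℤ AddCommGrpCat.{u}
  reduced (n : ℤ) (hn : n < r) : IsZero (B n)
  bdry : Boundary B ((sharp M).obj (mooreSum.obj B))

/-- A morphism of homological bypes: a homomorphism `φ` of graded abelian groups such that there is
a chain map `α : C(B) → C(B')` with `H_* α = 0` for which
`M_# C(φ) + P (α ⊗ C(φ)) H + M_# α` is compatible with the boundary invariants. -/
@[ext]
structure HBype.Hom {M : QuadraticModule.{u}} {r : ℕ} (X X' : HBype M r) where
  hom : X.B ⟶ X'.B
  compat : ∃ α : mooreSum.obj X.B ⟶ mooreSum.obj X'.B,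
    (∀ n, HomologicalComplex.homologyMap α n = 0) ∧
    X.bdry.Compat X'.bdry hom (sharpAdd M (mooreSum.map hom) α)

/-- The category `Hbype_r(M)`. -/
instance (r : ℕ) : Category (HBype M r) where
  Hom := HBype.Hom
  id X := ⟨𝟙 _, 0, fun n => by simp, by
    rw [← sharp_map_add, add_zero, CategoryTheory.Functor.map_id, CategoryTheory.Functor.map_id]
    exact Boundary.Compat.id _⟩
  comp {X X' X''} φ ψ := ⟨φ.hom ≫ ψ.hom, by
    obtain ⟨α, hα, h⟩ := φ.compat
    obtain ⟨α', hα', h'⟩ := ψ.compat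
    refine ⟨mooreSum.map φ.hom ≫ α' + α ≫ mooreSum.map ψ.hom + α ≫ α', fun n => ?_, ?_⟩
    · simp [HomologicalComplex.homologyMap_add, HomologicalComplex.homologyMap_comp, hα, hα']
    · rw [← sharp_map_add] at h h' ⊢
      have e : mooreSum.map (φ.hom ≫ ψ.hom) +
          (mooreSum.map φ.hom ≫ α' + α ≫ mooreSum.map ψ.hom + α ≫ α') =
          (mooreSum.map φ.hom + α) ≫ (mooreSum.map ψ.hom + α') := by
        rw [Functor.map_comp, Preadditive.add_comp, Preadditive.comp_add, Preadditive.comp_add]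
        abel
      rw [e, Functor.map_comp]
      exact h.comp h'⟩
  id_comp φ := HBype.Hom.ext (Category.id_comp _)
  comp_id φ := HBype.Hom.ext (Category.comp_id _)
  assoc φ ψ χ := HBype.Hom.ext (Category.assoc _ _ _)

/-- The forgetful functor `Hbype_r(M) → Ab_*`, `(B, b, β) ↦ B`. -/
def HBype.forget (r : ℕ) : HBype M r ⥤ GradedObject ℤ AddCommGrpCat.{u} where
  obj X := X.B
  map φ := φ.hom

/-! ### Comparison of `C(H_* Y)` and `Y` -/

/-- The chain map `i : C(H_* Y) → Y` induces the identity of `H_* Y` in homology: on each summand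
`C(H_n Y, n)` the homomorphism `H_n(i)` is the canonical map `H_n C(H_n Y, n) → H_n Y`. -/
def InducesId {Y : Cx.{u}} (i : mooreSum.obj (gradedHomology Y) ⟶ Y) : Prop :=
  ∀ n, HomologicalComplex.homologyMap
    (Limits.Sigma.ι (fun n => moore (Y.homology n) n) n ≫ i) n = mooreAug (Y.homology n) n

lemma isZero_homology {Y : Cx.{u}} {n : ℤ} (h : IsZero (Y.X n)) : IsZero (Y.homology n) :=
  ShortComplex.isZero_homology_of_isZero_X₂ _ h

/-- The object `(H_* Y, b, β)` of `Hbype_r(M)`, for boundary invariants `(b, β)`. -/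
noncomputable def Bype.toHBype {M : QuadraticModule.{u}} {r : ℕ} (X : Bype M r)
    (s : Boundary (gradedHomology X.Y) ((sharp M).obj (mooreSum.obj (gradedHomology X.Y)))) :
    HBype M r where
  B := gradedHomology X.Y
  reduced n hn := isZero_homology (X.reduced n hn)
  bdry := s

end QuadBype

open QuadBype

/-! Compatibility with boundary invariants is stable under composition and under passage to homotopy
inverses (`Boundary.Compat.inv`), and invariants can be transported along an isomorphism
(`Boundary.exists_compat`). Everything else comes from two facts about chain complexes.

First, `M_#` preserves homotopies out of non-negative complexes (`nonempty_sharp_homotopy`). Since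
`⊗ M` is not additive, a chain homotopy cannot be pushed through it; a simplicial homotopy can,
because any functor may be applied to it degreewise. So if `f` and `f'` are homotopic, a
null-homotopy of the normalization of `g = f' - f` is turned into a lift of `g` to the décalage,
which is a path object (`exists_decalage_lift`). Such a lift gives an explicit simplicial homotopy
from `0` to `g` (`decalageHomotopy`), and the constant homotopy at `f` is added to it.

Second, a quasi-isomorphism between non-negative complexes of projectives is a homotopy equivalence
(`exists_homotopyEquiv`). It applies to `C(B)` because subgroups of free abelian groups are free, so
that relation groups are free. In particular `i : C(H_* Y) → Y` has a homotopy inverse, and `M_# i`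
becomes invertible up to homotopy.

By the quadratic formula for `M_# (f + g)`, the condition on a morphism `φ` of homological bypes
asks for a chain map `a = C(φ) + α` that induces `φ` in homology and for which `M_# a` is compatible
(`Boundary.exists_compat_sharpAdd_iff`). A chain map `f : Y → Y'` then gives `a = i f i'⁻¹`, which
defines the functor; conversely `a` gives `f = i⁻¹ a i'`, which is fullness. Isomorphisms are
reflected because an isomorphism in homology has a homotopy inverse, and `(B, b, β)` is reached from
the complex `Y = C(B)`. -/

/-! ### Freeness of submodules over a principal ideal domain. -/

/-- Submodules of `ι →₀ R`, for a principal ideal domain `R`, are free. -/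
theorem Submodule.free_of_finsupp_pid {R ι : Type*} [CommRing R] [IsDomain R]
    [IsPrincipalIdealRing R] (N : Submodule R (ι →₀ R)) : Module.Free R N := by
  classical
  -- Well-order the index set and filter `N` by the largest index in the support.
  obtain ⟨r, hr⟩ := exists_wellFoundedLT ι
  let N' (i : ι) : Submodule R (ι →₀ R) := N ⊓ Finsupp.supported R R (Set.Iic i)
  -- The `i`-th coordinates of the elements of `N' i` form a principal ideal; `v i` is an element
  -- whose coordinate generates it. The `v i` with nonzero generator will form the basis.
  have hv (i : ι) : ∃ v ∈ N' i, ∀ x ∈ N' i, ∃ c, c * v i = x i := by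
    obtain ⟨v, hv, hvi⟩ := Submodule.IsPrincipal.generator_mem
      ((N' i).map (Finsupp.lapply (R := R) i))
    refine ⟨v, hv, fun x hx => ?_⟩
    obtain ⟨c, hc⟩ := (Submodule.IsPrincipal.mem_iff_eq_smul_generator _).1
      (Submodule.mem_map_of_mem (f := Finsupp.lapply (R := R) i) hx)
    exact ⟨c, by rw [← hvi] at hc; exact hc.symm⟩
  choose v hvN hvx using hv
  have hvz {i k : ι} (h : i < k) : v i k = 0 := by
    by_contra hne
    exact absurd ((hvN i).2 (Finsupp.mem_support_iff.2 hne)) (not_le.2 h)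
  let w (j : {i // v i i ≠ 0}) : N := ⟨v j.1, (hvN j.1).1⟩
  have hli : LinearIndependent R fun j : {i // v i i ≠ 0} => v j.1 := by
    refine linearIndependent_iff.2 fun l hl => ?_
    by_contra hne
    have hs : l.support.Nonempty := Finsupp.support_nonempty_iff.2 hne
    set j := l.support.max' hs with hj
    have hmem : j ∈ l.support := Finset.max'_mem _ hs
    -- Read the relation in the coordinate of its largest index `j`: the vectors with smaller index
    -- vanish there.
    have h0 : ∑ k ∈ l.support, l k * v k.1 j.1 = 0 := by
      have h1 := DFunLike.congr_fun hl j.1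
      rw [Finsupp.linearCombination_apply, Finsupp.sum, Finsupp.finsetSum_apply] at h1
      exact h1
    rw [Finset.sum_eq_single j] at h0
    · exact (mul_ne_zero (Finsupp.mem_support_iff.1 hmem) j.2) h0
    · intro k hk hkj
      rw [hvz (lt_of_le_of_ne (Finset.le_max' _ k hk) fun h => hkj (Subtype.ext h)), mul_zero]
    · exact fun h => absurd hmem h
  -- Well-founded induction on the leading index: subtracting a multiple of `v i` kills the `i`-th
  -- coordinate, and the remainder has a smaller leading index.
  have hsp (i : ι) : ∀ x ∈ N' i, x ∈ (Submodule.span R (Set.range w)).map N.subtype := by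
    induction i using WellFoundedLT.induction with
    | ind i ih =>
    intro x hx
    obtain ⟨c, hc⟩ := hvx i x hx
    have hcv : c • v i ∈ (Submodule.span R (Set.range w)).map N.subtype ∨ v i i = 0 := by
      by_cases h0 : v i i = 0
      · exact Or.inr h0
      · exact Or.inl ⟨c • w ⟨i, h0⟩, Submodule.smul_mem _ _ (Submodule.subset_span ⟨_, rfl⟩), rfl⟩
    have hsmall : ∀ y ∈ N' i, y i = 0 →
        y ∈ (Submodule.span R (Set.range w)).map N.subtype := by
      intro y hy hyi
      by_cases hy0 : y = 0
      · rw [hy0]; exact zero_mem _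
      have hs : y.support.Nonempty := Finsupp.support_nonempty_iff.2 hy0
      have hm := Finset.max'_mem _ hs
      have hle : y.support.max' hs ≤ i := hy.2 hm
      refine ih _ (lt_of_le_of_ne hle ?_) y ⟨hy.1, fun k hk => Finset.le_max' _ k hk⟩
      intro h
      rw [h] at hm
      exact (Finsupp.mem_support_iff.1 hm) hyi
    rcases hcv with hcv | h0
    · have := add_mem (hsmall (x - c • v i) (sub_mem hx (Submodule.smul_mem _ _ (hvN i)))
        (by simp [hc])) hcv
      simpa using this
    · exact hsmall x hx (by rw [← hc, h0, mul_zero])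
  refine Module.Free.of_basis (Module.Basis.mk (v := w) (.of_comp N.subtype hli) ?_)
  rintro ⟨x, hx⟩ -
  by_cases hx0 : x = 0
  · subst hx0
    exact zero_mem _
  have hs : x.support.Nonempty := Finsupp.support_nonempty_iff.2 hx0
  obtain ⟨y, hy, hyx⟩ := hsp (x.support.max' hs) x ⟨hx, fun k hk => Finset.le_max' _ k hk⟩
  have : y = ⟨x, hx⟩ := Subtype.ext hyx
  rwa [← this]

/-- A module which embeds into a free module over a principal ideal domain is free. -/
theorem Module.Free.of_injective_pid {R M N : Type*} [CommRing R] [IsDomain R]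
    [IsPrincipalIdealRing R] [AddCommGroup M] [Module R M] [AddCommGroup N] [Module R N]
    [Module.Free R M] (f : N →ₗ[R] M) (hf : Function.Injective f) : Module.Free R N := by
  let g := (Module.Free.chooseBasis R M).repr.toLinearMap ∘ₗ f
  have hg : Function.Injective g := (Module.Free.chooseBasis R M).repr.injective.comp hf
  have := Submodule.free_of_finsupp_pid (LinearMap.range g)
  exact Module.Free.of_equiv (LinearEquiv.ofInjective g hg).symm

/-! ### Projective and free abelian groups. -/

namespace QuadBype

lemma projective_of_free (A : AddCommGrpCat.{u}) [Module.Free ℤ A] : Projective A where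
  factors {E X} f e he := by
    have hs : Function.Surjective e.hom := (AddCommGrpCat.epi_iff_surjective e).1 he
    obtain ⟨h, hh⟩ := Module.projective_lifting_property e.hom.toIntLinearMap
      f.hom.toIntLinearMap hs
    refine ⟨AddCommGrpCat.ofHom h.toAddMonoidHom, ?_⟩
    ext x
    exact LinearMap.congr_fun hh x

/-- A projective group splits off the free group on its own elements, so it is a subgroup of a free
group. -/
lemma free_of_projective (A : AddCommGrpCat.{u}) [Projective A] : Module.Free ℤ A := by
  let p : (A →₀ ℤ) →ₗ[ℤ] A := Finsupp.linearCombination ℤ id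
  have hp : Function.Surjective p := Finsupp.linearCombination_id_surjective ℤ A
  let q : AddCommGrpCat.of (ULift.{u} (A →₀ ℤ)) ⟶ A :=
    AddCommGrpCat.ofHom (p.toAddMonoidHom.comp AddEquiv.ulift.toAddMonoidHom)
  have hq : Epi q := (AddCommGrpCat.epi_iff_surjective q).2 fun x => by
    obtain ⟨y, rfl⟩ := hp x
    exact ⟨ULift.up y, rfl⟩
  let s : A ⟶ AddCommGrpCat.of (ULift.{u} (A →₀ ℤ)) := Projective.factorThru (𝟙 A) q
  have hs : s ≫ q = 𝟙 A := Projective.factorThru_comp _ _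
  refine Module.Free.of_injective_pid
    (AddEquiv.ulift.toAddMonoidHom.comp s.hom).toIntLinearMap (M := A →₀ ℤ) ?_
  intro x y hxy
  have hxy' : s x = s y := ULift.ext _ _ hxy
  have h := congrArg q hxy'
  rwa [← ConcreteCategory.comp_apply, ← ConcreteCategory.comp_apply, hs] at h

lemma projective_of_mono {A B : AddCommGrpCat.{u}} (f : A ⟶ B) [Mono f] [Projective B] :
    Projective A := by
  have := free_of_projective B
  have := Module.Free.of_injective_pid f.hom.toIntLinearMap
    ((AddCommGrpCat.mono_iff_injective f).1 inferInstance)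
  exact projective_of_free A

instance (A : AddCommGrpCat.{u}) : Projective (resF A) where
  factors {E X} f e he := by
    have hs := (AddCommGrpCat.epi_iff_surjective e).1 he
    choose g hg using hs
    refine ⟨AddCommGrpCat.ofHom (FreeAbelianGroup.lift fun a => g (f (FreeAbelianGroup.of a))), ?_⟩
    ext1
    apply FreeAbelianGroup.lift_ext
    intro a
    simp [hg]

instance (A : AddCommGrpCat.{u}) : Projective (resK A) := projective_of_mono (resd A)

end QuadBype

/-! ### Operators of the simplex category behind the décalage homotopy. -/

namespace SimplexCategory

open scoped Simplicial

/-- The functor `[n] ↦ [0] * [n] = [n + 1]` which adds a new initial vertex. -/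
def leftCone : SimplexCategory ⥤ SimplexCategory where
  obj n := ⦋n.len + 1⦌
  map {n m} f := SimplexCategory.mkHom
    ⟨Fin.cases 0 fun i => (f i).succ, by
      intro i j hij
      cases i using Fin.cases with
      | zero => exact Fin.zero_le _
      | succ i =>
        cases j using Fin.cases with
        | zero => exact absurd hij (by simp)
        | succ j =>
          exact Fin.succ_le_succ_iff.2 (f.toOrderHom.monotone (Fin.succ_le_succ_iff.1 hij))⟩
  map_id n := by
    ext i : 3
    cases i using Fin.cases <;> rfl
  map_comp f g := by
    ext i : 3
    cases i using Fin.cases <;> rfl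

lemma leftCone_map_δ {n : ℕ} (i : Fin (n + 2)) : leftCone.map (δ i) = δ i.succ := by
  ext j : 3
  cases j using Fin.cases with
  | zero => rfl
  | succ j => exact (Fin.succ_succAbove_succ i j).symm

lemma leftCone_map_σ {n : ℕ} (i : Fin (n + 1)) : leftCone.map (σ i) = σ i.succ := by
  ext j : 3
  cases j using Fin.cases with
  | zero => rfl
  | succ j => exact (Fin.succ_predAbove_succ i j).symm

/-- Naturality of the inclusion of the old vertices, which makes the forgotten face of a décalage a
simplicial map. -/
lemma δ_zero_leftCone_map {n m : SimplexCategory} (f : n ⟶ m) :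
    δ (n := n.len) 0 ≫ leftCone.map f = f ≫ δ (n := m.len) 0 := by
  ext j : 3
  rfl

/-- The map `j ↦ max i j`. -/
def maxHom {n : ℕ} (i : Fin (n + 1)) : (⦋n⦌ : SimplexCategory) ⟶ ⦋n⦌ :=
  SimplexCategory.mkHom ⟨fun j => max i j, fun _ _ h => max_le_max le_rfl h⟩

/-- The map which sends `j ≤ i` to `0` and fixes `j > i`. -/
def collapseHom {n : ℕ} (i : Fin (n + 1)) : (⦋n + 1⦌ : SimplexCategory) ⟶ ⦋n + 1⦌ :=
  SimplexCategory.mkHom ⟨fun j => if j ≤ i.castSucc then 0 else j, by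
    intro j k h
    dsimp
    split_ifs with h1 h2
    · exact le_rfl
    · exact Fin.zero_le _
    · exact absurd (h.trans ‹_›) h1
    · exact h⟩

/-- Reduces identities between simplicial operators to case distinctions on natural numbers, which
`omega` settles. -/
lemma hom_ext_val {n m : ℕ} {f g : (⦋n⦌ : SimplexCategory) ⟶ ⦋m⦌}
    (h : ∀ j : Fin (n + 1), (f j).val = (g j).val) : f = g := by
  ext j : 3
  exact Fin.ext (h j)

lemma comp_val {n m k : ℕ} (f : (⦋n⦌ : SimplexCategory) ⟶ ⦋m⦌) (g : (⦋m⦌ : SimplexCategory) ⟶ ⦋k⦌)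
    (j : Fin (n + 1)) : ((f ≫ g) j).val = (g (f j)).val := rfl

lemma δ_val {n : ℕ} (i : Fin (n + 2)) (j : Fin (n + 1)) :
    ((δ i) j).val = if j.val < i.val then j.val else j.val + 1 := by
  change (Fin.succAbove i j).val = _
  rw [Fin.succAbove]
  split_ifs with h1 h2 h2 <;> simp_all [Fin.lt_def]

lemma σ_val {n : ℕ} (i : Fin (n + 1)) (j : Fin (n + 2)) :
    ((σ i) j).val = if j.val ≤ i.val then j.val else j.val - 1 := by
  change (Fin.predAbove i j).val = _
  by_cases h : j ≤ i.castSucc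
  · rw [Fin.predAbove_of_le_castSucc _ _ h, if_pos (show j.val ≤ i.val from h)]
    rfl
  · rw [Fin.predAbove_of_castSucc_lt _ _ (not_le.1 h), if_neg (show ¬ j.val ≤ i.val from h)]
    rfl

lemma maxHom_val {n : ℕ} (i : Fin (n + 1)) (j : Fin (n + 1)) :
    ((maxHom i) j).val = if j.val ≤ i.val then i.val else j.val := by
  change (max i j).val = _
  rw [Fin.coe_max]
  split_ifs <;> omega

lemma collapseHom_val {n : ℕ} (i : Fin (n + 1)) (j : Fin (n + 2)) :
    ((collapseHom i) j).val = if j.val ≤ i.val then 0 else j.val := by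
  change (if j ≤ i.castSucc then (0 : Fin (n + 2)) else j).val = _
  simp only [Fin.le_def, Fin.val_castSucc]
  split_ifs <;> rfl

/-- The map `[n + 1] → [m + 1]` induced by `f : [n] → [m]`. -/
abbrev coneHom {n m : ℕ} (f : (⦋n⦌ : SimplexCategory) ⟶ ⦋m⦌) :
    (⦋n + 1⦌ : SimplexCategory) ⟶ ⦋m + 1⦌ := leftCone.map f

lemma coneHom_val {n m : ℕ} (f : (⦋n⦌ : SimplexCategory) ⟶ ⦋m⦌) (j : Fin (n + 2)) :
    ((coneHom f) j).val = if h : j.val = 0 then 0 else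
      (f ⟨j.val - 1, by simp; omega⟩).val + 1 := by
  cases j using Fin.cases with
  | zero => rfl
  | succ j => rfl

/-- From here on the identities for `maxHom` and `collapseHom` come in pairs: one acts on the source
side of a homotopy component and one on the target side, and each pair gives one axiom of
`decalageHomotopy`. -/
lemma maxHom_comp_δ_of_le {n : ℕ} (i : Fin (n + 2)) (j : Fin (n + 1)) (h : i ≤ j.castSucc) :
    maxHom j ≫ δ i = δ i ≫ maxHom j.succ := by
  rw [Fin.le_def, Fin.val_castSucc] at h
  refine hom_ext_val fun k => ?_
  simp only [comp_val, δ_val, maxHom_val, Fin.val_succ]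
  split_ifs <;> omega

lemma collapseHom_comp_δ_of_le {n : ℕ} (i : Fin (n + 2)) (j : Fin (n + 1)) (h : i ≤ j.castSucc) :
    collapseHom j ≫ δ i.succ = δ i.castSucc ≫ collapseHom j.succ := by
  rw [Fin.le_def, Fin.val_castSucc] at h
  refine hom_ext_val fun k => ?_
  simp only [comp_val, δ_val, collapseHom_val, Fin.val_succ, Fin.val_castSucc]
  split_ifs <;> omega

lemma maxHom_comp_δ_of_lt {n : ℕ} (i : Fin (n + 2)) (j : Fin (n + 1)) (h : j.castSucc < i) :
    maxHom j ≫ δ i = δ i ≫ maxHom j.castSucc := by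
  rw [Fin.lt_def, Fin.val_castSucc] at h
  refine hom_ext_val fun k => ?_
  simp only [comp_val, δ_val, maxHom_val, Fin.val_castSucc]
  split_ifs <;> omega

lemma collapseHom_comp_δ_of_lt {n : ℕ} (i : Fin (n + 2)) (j : Fin (n + 1)) (h : j.castSucc < i) :
    collapseHom j ≫ δ i.succ = δ i.succ ≫ collapseHom j.castSucc := by
  rw [Fin.lt_def, Fin.val_castSucc] at h
  refine hom_ext_val fun k => ?_
  simp only [comp_val, δ_val, collapseHom_val, Fin.val_succ, Fin.val_castSucc]
  split_ifs <;> omega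

lemma maxHom_comp_σ_of_le {n : ℕ} (i j : Fin (n + 1)) (h : i ≤ j) :
    maxHom j.succ ≫ σ i = σ i ≫ maxHom j := by
  rw [Fin.le_def] at h
  refine hom_ext_val fun k => ?_
  simp only [comp_val, σ_val, maxHom_val, Fin.val_succ]
  split_ifs <;> omega

lemma collapseHom_comp_σ_of_le {n : ℕ} (i j : Fin (n + 1)) (h : i ≤ j) :
    collapseHom j.succ ≫ σ i.succ = σ i.castSucc ≫ collapseHom j := by
  rw [Fin.le_def] at h
  refine hom_ext_val fun k => ?_
  simp only [comp_val, σ_val, collapseHom_val, Fin.val_succ, Fin.val_castSucc]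
  split_ifs <;> omega

lemma maxHom_comp_σ_of_ge {n : ℕ} (i j : Fin (n + 1)) (h : j ≤ i) :
    maxHom j.castSucc ≫ σ i = σ i ≫ maxHom j := by
  rw [Fin.le_def] at h
  refine hom_ext_val fun k => ?_
  simp only [comp_val, σ_val, maxHom_val, Fin.val_castSucc]
  split_ifs <;> omega

lemma collapseHom_comp_σ_of_ge {n : ℕ} (i j : Fin (n + 1)) (h : j ≤ i) :
    collapseHom j.castSucc ≫ σ i.succ = σ i.succ ≫ collapseHom j := by
  rw [Fin.le_def] at h
  refine hom_ext_val fun k => ?_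
  simp only [comp_val, σ_val, collapseHom_val, Fin.val_succ, Fin.val_castSucc]
  split_ifs <;> omega

/-- Together with the next two lemmas this matches adjacent components on their common face: the
extra factor `maxHom j.succ` is moved across the lift, where it is absorbed. -/
lemma maxHom_comp_maxHom {n : ℕ} (j : Fin (n + 1)) :
    maxHom j.succ ≫ maxHom j.castSucc = maxHom j.succ := by
  refine hom_ext_val fun k => ?_
  simp only [comp_val, maxHom_val, Fin.val_succ, Fin.val_castSucc]
  split_ifs <;> omega

lemma δ_comp_collapseHom {n : ℕ} (j : Fin (n + 1)) :
    δ j.castSucc.succ ≫ collapseHom j.succ = δ j.castSucc.succ ≫ collapseHom j.castSucc := by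
  refine hom_ext_val fun k => ?_
  simp only [comp_val, collapseHom_val, δ_val, Fin.val_succ, Fin.val_castSucc]
  split_ifs <;> omega

lemma δ_comp_collapseHom_leftCone {n : ℕ} (j : Fin (n + 1)) :
    δ j.castSucc.succ ≫ collapseHom j.castSucc ≫ coneHom (maxHom j.succ) =
      δ j.castSucc.succ ≫ collapseHom j.succ := by
  refine hom_ext_val fun k => ?_
  simp only [comp_val, collapseHom_val, δ_val, coneHom_val, maxHom_val, Fin.val_succ,
    Fin.val_castSucc]
  split_ifs <;> omega

lemma maxHom_zero (n : ℕ) : maxHom (0 : Fin (n + 1)) = 𝟙 _ := by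
  refine hom_ext_val fun k => ?_
  rw [maxHom_val]
  change ite (k.val ≤ 0) 0 k.val = k.val
  split_ifs <;> omega

lemma δ_zero_comp_collapseHom (n : ℕ) :
    δ (0 : Fin (n + 2)) ≫ collapseHom 0 = δ 0 := by
  refine hom_ext_val fun k => ?_
  simp only [comp_val, collapseHom_val, δ_val]
  simp

/-- The map `[n] → [0]`. -/
def toZero (n : ℕ) : (⦋n⦌ : SimplexCategory) ⟶ ⦋0⦌ :=
  SimplexCategory.mkHom ⟨fun _ => 0, fun _ _ _ => le_rfl⟩

/-- The map `[0] → [n]` with image `n`. -/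
def lastVertex (n : ℕ) : (⦋0⦌ : SimplexCategory) ⟶ ⦋n⦌ :=
  SimplexCategory.mkHom ⟨fun _ => Fin.last n, fun _ _ _ => le_rfl⟩

lemma maxHom_last (n : ℕ) : maxHom (Fin.last n) = toZero n ≫ lastVertex n := by
  refine hom_ext_val fun k => ?_
  rw [maxHom_val]
  change _ = n
  simp only [Fin.val_last]
  split_ifs <;> omega

lemma δ_last_comp_collapseHom (n : ℕ) :
    δ (Fin.last (n + 1)) ≫ collapseHom (Fin.last n) ≫ coneHom (toZero n) =
      toZero n ≫ δ 1 := by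
  refine hom_ext_val fun k => ?_
  simp only [comp_val, collapseHom_val, δ_val, coneHom_val, Fin.val_last]
  change _ = 0
  split_ifs <;> omega

end SimplexCategory

/-! ### The décalage and its simplicial null-homotopies. -/

namespace CategoryTheory.SimplicialObject

open Opposite SimplexCategory
open scoped Simplicial

universe v w

section

variable {C : Type w} [Category.{v} C]

/-- The décalage of a simplicial object, which forgets the face `δ 0`. -/
abbrev decalage (X : SimplicialObject C) : SimplicialObject C := leftCone.op ⋙ X

/-- The forgotten face, as a map from the décalage. -/
def decalageδ (X : SimplicialObject C) : X.decalage ⟶ X where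
  app n := X.map (SimplexCategory.δ (n := n.unop.len) 0).op
  naturality _ _ f :=
    (X.map_comp _ _).symm.trans ((congrArg (fun t => X.map (Quiver.Hom.op t))
      (δ_zero_leftCone_map f.unop)).trans (X.map_comp _ _))

variable {X Y : SimplicialObject C} (G : X ⟶ Y.decalage)

/-- The components of a map to a décalage. -/
def coneApp (n : ℕ) : X _⦋n⦌ ⟶ Y _⦋n + 1⦌ := G.app (op ⦋n⦌)

lemma coneApp_naturality {n m : ℕ} (θ : (⦋n⦌ : SimplexCategory) ⟶ ⦋m⦌) :
    X.map θ.op ≫ coneApp G n = coneApp G m ≫ Y.map (coneHom θ).op :=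
  G.naturality θ.op

lemma decalage_δ {n : ℕ} (i : Fin (n + 2)) :
    SimplicialObject.δ Y.decalage i = Y.δ i.succ :=
  congrArg (fun t => Y.map (Quiver.Hom.op t)) (SimplexCategory.leftCone_map_δ i)

lemma comp_decalageδ_app (n : ℕ) : (G ≫ Y.decalageδ).app (op ⦋n⦌) = coneApp G n ≫ Y.δ 0 := rfl

/-- The composition of a map to a décalage with simplicial operators on both sides. -/
def coneComp {n m p : ℕ} (D : (⦋n⦌ : SimplexCategory) ⟶ ⦋m⦌)
    (S : (⦋p⦌ : SimplexCategory) ⟶ ⦋n + 1⦌) : X _⦋m⦌ ⟶ Y _⦋p⦌ :=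
  X.map D.op ≫ coneApp G n ≫ Y.map S.op

/-- Naturality of `G` lets an operator cross from the source to the target, at the price of being
coned. -/
lemma coneComp_comp {n n' m p : ℕ} (θ : (⦋n'⦌ : SimplexCategory) ⟶ ⦋n⦌)
    (D : (⦋n⦌ : SimplexCategory) ⟶ ⦋m⦌) (S : (⦋p⦌ : SimplexCategory) ⟶ ⦋n' + 1⦌) :
    coneComp G (θ ≫ D) S = coneComp G D (S ≫ coneHom θ) := by
  unfold coneComp
  rw [op_comp, op_comp, X.map_comp, Y.map_comp, Category.assoc,
    reassoc_of% (coneApp_naturality G θ)]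

lemma coneComp_map {n m p q : ℕ} (D : (⦋n⦌ : SimplexCategory) ⟶ ⦋m⦌)
    (S : (⦋p⦌ : SimplexCategory) ⟶ ⦋n + 1⦌) (f : (⦋q⦌ : SimplexCategory) ⟶ ⦋p⦌) :
    coneComp G D S ≫ Y.map f.op = coneComp G D (f ≫ S) := by
  unfold coneComp
  rw [op_comp, Y.map_comp, Category.assoc, Category.assoc]

lemma map_coneComp {n m p q : ℕ} (D : (⦋n⦌ : SimplexCategory) ⟶ ⦋m⦌)
    (S : (⦋p⦌ : SimplexCategory) ⟶ ⦋n + 1⦌) (f : (⦋m⦌ : SimplexCategory) ⟶ ⦋q⦌) :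
    X.map f.op ≫ coneComp G D S = coneComp G (D ≫ f) S := by
  unfold coneComp
  rw [op_comp, X.map_comp, Category.assoc]

end

variable {C : Type w} [Category.{v} C] [Preadditive C]
variable {X Y : SimplicialObject C}

/-- The simplicial null-homotopy given by a lift to the décalage. -/
def decalageHomotopy (G : X ⟶ Y.decalage) (hG : coneApp G 0 ≫ Y.δ 1 = 0) :
    Homotopy (0 : X ⟶ Y) (G ≫ Y.decalageδ) where
  -- `G` adds a cone point to a simplex `x`. The `i`-th prism simplex has `i + 1` copies of the cone
  -- point as its first vertices, followed by the vertices `i, ..., n` of `x`; thus the homotopy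
  -- runs from the cone point to `x`.
  h i := coneComp G (maxHom i) (collapseHom i)
  h_zero_comp_δ_zero n := by
    rw [SimplicialObject.δ, coneComp_map, maxHom_zero, δ_zero_comp_collapseHom, coneComp, op_id,
      X.map_id, Category.id_comp, comp_decalageδ_app]
    rfl
  h_last_comp_δ_last n := by
    rw [SimplicialObject.δ] at hG ⊢
    -- At the last index the source operator factors through `[0]`, so only `G` in degree `0`
    -- enters, followed by `δ 1`; this is the composite that `hG` kills.
    rw [coneComp_map, maxHom_last, coneComp_comp, Category.assoc,
      δ_last_comp_collapseHom, coneComp, op_comp, Y.map_comp, reassoc_of% hG]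
    simp
  h_succ_comp_δ_castSucc_of_lt i j hij := by
    rw [SimplicialObject.δ, SimplicialObject.δ, coneComp_map, map_coneComp,
      maxHom_comp_δ_of_le _ _ hij, coneComp_comp, coneHom, leftCone_map_δ,
      collapseHom_comp_δ_of_le _ _ hij]
  h_succ_comp_δ_castSucc_succ j := by
    rw [SimplicialObject.δ, coneComp_map, coneComp_map, ← maxHom_comp_maxHom, coneComp_comp,
      δ_comp_collapseHom, Category.assoc, δ_comp_collapseHom_leftCone, δ_comp_collapseHom]
  h_castSucc_comp_δ_succ_of_lt i j hij := by
    rw [SimplicialObject.δ, SimplicialObject.δ, coneComp_map, map_coneComp,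
      maxHom_comp_δ_of_lt _ _ hij, coneComp_comp, coneHom, leftCone_map_δ,
      collapseHom_comp_δ_of_lt _ _ hij]
  h_comp_σ_castSucc_of_le i j hij := by
    rw [SimplicialObject.σ, SimplicialObject.σ, coneComp_map, map_coneComp,
      maxHom_comp_σ_of_le _ _ hij, coneComp_comp, coneHom, leftCone_map_σ,
      collapseHom_comp_σ_of_le _ _ hij]
  h_comp_σ_succ_of_lt i j hij := by
    rw [SimplicialObject.σ, SimplicialObject.σ, coneComp_map, map_coneComp,
      maxHom_comp_σ_of_ge _ _ hij, coneComp_comp, coneHom, leftCone_map_σ,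
      collapseHom_comp_σ_of_ge _ _ hij]

/-- The sum of simplicial homotopies. -/
def Homotopy.add {f g f' g' : X ⟶ Y} (H : Homotopy f g) (H' : Homotopy f' g') :
    Homotopy (f + f') (g + g') where
  h i := H.h i + H'.h i
  h_zero_comp_δ_zero n := by
    rw [Preadditive.add_comp, H.h_zero_comp_δ_zero, H'.h_zero_comp_δ_zero]; rfl
  h_last_comp_δ_last n := by
    rw [Preadditive.add_comp, H.h_last_comp_δ_last, H'.h_last_comp_δ_last]; rfl
  h_succ_comp_δ_castSucc_of_lt i j hij := by
    rw [Preadditive.add_comp, Preadditive.comp_add, H.h_succ_comp_δ_castSucc_of_lt i j hij,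
      H'.h_succ_comp_δ_castSucc_of_lt i j hij]
  h_succ_comp_δ_castSucc_succ j := by
    rw [Preadditive.add_comp, Preadditive.add_comp, H.h_succ_comp_δ_castSucc_succ j,
      H'.h_succ_comp_δ_castSucc_succ j]
  h_castSucc_comp_δ_succ_of_lt i j hij := by
    rw [Preadditive.add_comp, Preadditive.comp_add, H.h_castSucc_comp_δ_succ_of_lt i j hij,
      H'.h_castSucc_comp_δ_succ_of_lt i j hij]
  h_comp_σ_castSucc_of_le i j hij := by
    rw [Preadditive.add_comp, Preadditive.comp_add, H.h_comp_σ_castSucc_of_le i j hij,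
      H'.h_comp_σ_castSucc_of_le i j hij]
  h_comp_σ_succ_of_lt i j hij := by
    rw [Preadditive.add_comp, Preadditive.comp_add, H.h_comp_σ_succ_of_lt i j hij,
      H'.h_comp_σ_succ_of_lt i j hij]

end CategoryTheory.SimplicialObject

/-! ### From chain null-homotopies to simplicial homotopies and back. -/

namespace AlgebraicTopology.NormalizedMooreComplex

open Opposite CategoryTheory.SimplicialObject
open scoped Simplicial

universe v w

variable {C : Type w} [Category.{v} C] [Abelian C]

instance : (normalizedMooreComplex C).Full :=
  inferInstanceAs (Abelian.DoldKan.equivalence (A := C)).functor.Full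

instance : (normalizedMooreComplex C).Faithful :=
  inferInstanceAs (Abelian.DoldKan.equivalence (A := C)).functor.Faithful

/-- The inclusion of the normalized chains. -/
noncomputable def incl (X : SimplicialObject C) (n : ℕ) :
    ((normalizedMooreComplex C).obj X).X n ⟶ X _⦋n⦌ := (objX X n).arrow

variable (X Y : SimplicialObject C)

instance (n : ℕ) : Mono (incl X n) := inferInstanceAs (Mono (objX X n).arrow)

instance : IsIso (incl X 0) := (Subobject.isIso_arrow_iff_eq_top _).2 rfl

lemma incl_δ_succ {n : ℕ} (i : Fin (n + 1)) : incl X (n + 1) ≫ X.δ i.succ = 0 := by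
  have h := DoldKan.HigherFacesVanish.inclusionOfMooreComplexMap (X := X) n i (by omega)
  rwa [inclusionOfMooreComplexMap_f] at h

lemma d_incl (n : ℕ) :
    ((normalizedMooreComplex C).obj X).d (n + 1) n ≫ incl X n = incl X (n + 1) ≫ X.δ 0 := by
  rw [normalizedMooreComplex_objD]
  cases n with
  | zero =>
    have key {P Q R T : C} (a : P ⟶ Q) (b : Q ⟶ R) (i : T ⟶ R) (_ : IsIso i) :
        (a ≫ b ≫ inv i) ≫ i = a ≫ b := by simp
    exact key _ _ _ _
  | succ n =>
    rw [objD]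
    exact Subobject.factorThru_arrow _ _ _

variable {X Y}

lemma map_incl (g : X ⟶ Y) (n : ℕ) :
    ((normalizedMooreComplex C).map g).f n ≫ incl Y n = incl X n ≫ g.app (op ⦋n⦌) := by
  rw [normalizedMooreComplex_map, NormalizedMooreComplex.map_f]
  exact Subobject.factorThru_arrow _ _ _

lemma exists_lift_zero {W : C} (k : W ⟶ X _⦋0⦌) : ∃ l, l ≫ incl X 0 = k :=
  ⟨k ≫ inv (incl X 0), by simp⟩

lemma exists_lift_succ {W : C} {n : ℕ} (k : W ⟶ X _⦋n + 1⦌)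
    (hk : ∀ i : Fin (n + 1), k ≫ X.δ i.succ = 0) : ∃ l, l ≫ incl X (n + 1) = k := by
  have h : (objX X (n + 1)).Factors k := by
    rw [objX_add_one, Subobject.finset_inf_factors]
    exact fun i _ => kernelSubobject_factors _ _ (hk i)
  exact ⟨(objX X (n + 1)).factorThru k h, Subobject.factorThru_arrow _ _ h⟩

section

variable {g : X ⟶ Y}

/-- The components on normalized chains of the lift to the décalage given by a null-homotopy. -/
noncomputable def nullLift (h : Homotopy ((normalizedMooreComplex C).map g) 0) :
    ∀ n : ℕ, ((normalizedMooreComplex C).obj X).X n ⟶ Y _⦋n + 1⦌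
  | 0 => h.hom 0 1 ≫ incl Y 1
  -- The homotopy alone is killed by `δ 1` and accounts for only half of `g = dh + hd`. As `σ 0` is
  -- a section of both `δ 0` and `δ 1`, the second summand supplies the other half and makes the
  -- result a chain map.
  | n + 1 => h.hom (n + 1) (n + 2) ≫ incl Y (n + 2) +
      ((normalizedMooreComplex C).obj X).d (n + 1) n ≫ h.hom n (n + 1) ≫ incl Y (n + 1) ≫ Y.σ 0

lemma nullLift_zero_δ_one (h : Homotopy ((normalizedMooreComplex C).map g) 0) :
    nullLift h 0 ≫ Y.δ 1 = 0 := by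
  have h1 := incl_δ_succ Y (0 : Fin 1)
  rw [nullLift, Category.assoc]
  erw [h1]
  simp

lemma d_nullLift (h : Homotopy ((normalizedMooreComplex C).map g) 0) (n : ℕ) :
    ((normalizedMooreComplex C).obj X).d (n + 1) n ≫ nullLift h n =
    ((normalizedMooreComplex C).obj X).d (n + 1) n ≫ h.hom n (n + 1) ≫ incl Y (n + 1) := by
  cases n with
  | zero => rfl
  | succ n =>
    rw [nullLift, Preadditive.comp_add, HomologicalComplex.d_comp_d_assoc, zero_comp, add_zero]

/-- The differential of the normalized décalage is `Y.δ 1`, so this is the chain map condition. -/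
lemma nullLift_succ_δ_one (h : Homotopy ((normalizedMooreComplex C).map g) 0) (n : ℕ) :
    nullLift h (n + 1) ≫ Y.δ 1 =
    ((normalizedMooreComplex C).obj X).d (n + 1) n ≫ nullLift h n := by
  have h1 : incl Y (n + 2) ≫ Y.δ 1 = 0 := incl_δ_succ Y (0 : Fin (n + 2))
  have h2 : Y.σ (0 : Fin (n + 2)) ≫ Y.δ 1 = 𝟙 _ := Y.δ_comp_σ_succ (i := (0 : Fin (n + 2)))
  rw [d_nullLift, nullLift, Preadditive.add_comp]
  simp only [Category.assoc]
  rw [h1, h2, comp_zero, zero_add, Category.comp_id]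

/-- The positive faces of the décalage are the faces of `Y` from `δ 2` on, so this places the lift
in the normalized chains. -/
lemma nullLift_succ_δ (h : Homotopy ((normalizedMooreComplex C).map g) 0) (n : ℕ) (i : Fin (n + 1)) :
    nullLift h (n + 1) ≫ Y.δ i.succ.succ = 0 := by
  have h1 : incl Y (n + 2) ≫ Y.δ i.succ.succ = 0 := incl_δ_succ Y i.succ
  have h2 : Y.σ (0 : Fin (n + 2)) ≫ Y.δ i.succ.succ = Y.δ i.succ ≫ Y.σ 0 :=
    Y.δ_comp_σ_of_gt (i := i.succ) (j := 0) (Fin.succ_pos i)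
  rw [nullLift, Preadditive.add_comp]
  simp only [Category.assoc]
  rw [h1, h2, reassoc_of% (incl_δ_succ Y i)]
  simp

/-- This is the homotopy formula for `g`: the forgotten face of the lift recovers `g` on normalized
chains. -/
lemma nullLift_δ_zero (h : Homotopy ((normalizedMooreComplex C).map g) 0) (n : ℕ) :
    nullLift h n ≫ Y.δ 0 = incl X n ≫ g.app (op ⦋n⦌) := by
  rw [← map_incl]
  have h1 := h.comm n
  rw [HomologicalComplex.zero_f, add_zero] at h1
  cases n with
  | zero =>
    rw [Homotopy.dNext_zero_chainComplex, zero_add, Homotopy.prevD_chainComplex] at h1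
    rw [h1, nullLift, Category.assoc, Category.assoc, d_incl]
  | succ n =>
    have h2 : Y.σ (0 : Fin (n + 2)) ≫ Y.δ 0 = 𝟙 _ := Y.δ_comp_σ_self (i := (0 : Fin (n + 2)))
    rw [Homotopy.dNext_succ_chainComplex, Homotopy.prevD_chainComplex] at h1
    rw [h1, nullLift, Preadditive.add_comp, Preadditive.add_comp]
    simp only [Category.assoc]
    rw [d_incl, h2, Category.comp_id]
    exact add_comm _ _

/-- The inclusion of the normalized chains of the décalage. -/
noncomputable def decIncl (Y : SimplicialObject C) (n : ℕ) :
    ((normalizedMooreComplex C).obj Y.decalage).X n ⟶ Y _⦋n + 1⦌ := incl Y.decalage n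

instance (n : ℕ) : Mono (decIncl Y n) := inferInstanceAs (Mono (incl Y.decalage n))

lemma exists_nullLift_chainMap (h : Homotopy ((normalizedMooreComplex C).map g) 0) :
    ∃ k : (normalizedMooreComplex C).obj X ⟶ (normalizedMooreComplex C).obj Y.decalage,
      ∀ n, k.f n ≫ decIncl Y n = nullLift h n := by
  have hl (n : ℕ) : ∃ l, l ≫ decIncl Y n = nullLift h n := by
    cases n with
    | zero => exact exists_lift_zero (X := Y.decalage) (nullLift h 0)
    | succ n =>
      refine exists_lift_succ (X := Y.decalage) (nullLift h (n + 1)) fun i => ?_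
      rw [decalage_δ]
      exact nullLift_succ_δ h n i
  choose l hl using hl
  refine ⟨⟨l, ?_⟩, hl⟩
  rintro _ n rfl
  have h1 : ((normalizedMooreComplex C).obj Y.decalage).d (n + 1) n ≫ decIncl Y n =
      decIncl Y (n + 1) ≫ Y.δ 1 :=
    (d_incl Y.decalage n).trans (congrArg _ (decalage_δ 0))
  rw [← cancel_mono (decIncl Y n), Category.assoc, Category.assoc, hl, h1, reassoc_of% (hl (n + 1)),
    nullLift_succ_δ_one]

/-- Normalization is full and faithful by Dold–Kan: the chain map lifts to a simplicial map, and the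
equation for its forgotten face may be checked on normalized chains. -/
lemma exists_decalage_lift (h : Homotopy ((normalizedMooreComplex C).map g) 0) :
    ∃ G : X ⟶ Y.decalage, G ≫ Y.decalageδ = g ∧ coneApp G 0 ≫ Y.δ 1 = 0 := by
  obtain ⟨k, hk⟩ := exists_nullLift_chainMap h
  obtain ⟨G, rfl⟩ := (normalizedMooreComplex C).map_surjective k
  have hG (n : ℕ) : incl X n ≫ coneApp G n = nullLift h n := (map_incl G n).symm.trans (hk n)
  refine ⟨G, (normalizedMooreComplex C).map_injective ?_, ?_⟩
  · ext n
    rw [← cancel_mono (incl Y n), map_incl, map_incl, comp_decalageδ_app, reassoc_of% (hG n),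
      nullLift_δ_zero]
  · rw [← cancel_epi (incl X 0), reassoc_of% (hG 0), nullLift_zero_δ_one, comp_zero]

end

/-- If `N g` is null-homotopic, then `f` and `f + g` are simplicially homotopic. -/
lemma nonempty_homotopy_add (f : X ⟶ Y) {g : X ⟶ Y}
    (h : Homotopy ((normalizedMooreComplex C).map g) 0) :
    Nonempty (SimplicialObject.Homotopy f (f + g)) := by
  obtain ⟨G, rfl, hG⟩ := exists_decalage_lift h
  have H := (SimplicialObject.Homotopy.refl f).add (decalageHomotopy G hG)
  rw [add_zero] at H
  exact ⟨H⟩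

/-- Simplicial homotopies induce homotopies between maps of normalized complexes. -/
noncomputable def mapHomotopy {f g : X ⟶ Y} (H : SimplicialObject.Homotopy f g) :
    Homotopy ((normalizedMooreComplex C).map f) ((normalizedMooreComplex C).map g) :=
  -- The normalized complex is a natural retract of the alternating face map complex, where a
  -- simplicial homotopy yields a chain homotopy.
  have key (f : X ⟶ Y) : (normalizedMooreComplex C).map f = inclusionOfMooreComplexMap X ≫
      (alternatingFaceMapComplex C).map f ≫ DoldKan.PInftyToNormalizedMooreComplex Y := by
    have h1 := DoldKan.PInftyToNormalizedMooreComplex_naturality f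
    have h2 := (DoldKan.splitMonoInclusionOfMooreComplexMap X).id
    exact ((Category.assoc _ _ _).symm.trans ((congrArg (· ≫ NormalizedMooreComplex.map f) h2).trans
      (Category.id_comp _))).symm.trans (congrArg (_ ≫ ·) h1.symm)
  (Homotopy.ofEq (key f)).trans (((H.toChainHomotopy.compRight _).compLeft _).trans
    (Homotopy.ofEq (key g).symm))

end AlgebraicTopology.NormalizedMooreComplex

/-! ### Homotopy invariance of `M_#`, and homotopy equivalences of complexes of projectives. -/

namespace QuadBype

variable (M : QuadraticModule.{u})

/-- A chain complex is non-negative if it vanishes in negative degrees. -/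
def Nonneg (Y : Cx.{u}) : Prop := ∀ n : ℤ, n < 0 → IsZero (Y.X n)

lemma natEmb_f (n : ℕ) : natEmb.f n = (n : ℤ) := rfl

/-- The condition is vacuous: the degree `j + 1` before any `j ≥ 0` is again non-negative, so there
is no boundary degree to check. -/
lemma natEmb_hasLift {Y : Cx.{u}} {L : ChainComplex AddCommGrpCat.{u} ℕ}
    (φ : Y.restriction natEmb ⟶ L) : natEmb.HasLift φ := by
  intro j hj
  refine absurd ?_ (hj.2 (j + 1))
  rw [natEmb_f, natEmb_f]
  simp

/-- The projection of a chain complex onto its part in non-negative degrees. -/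
noncomputable def nonnegProj (Y : Cx.{u}) : Y ⟶ (Y.restriction natEmb).extend natEmb :=
  natEmb.liftExtend (𝟙 _) (natEmb_hasLift _)

lemma nonnegProj_naturality {Y Y' : Cx.{u}} (f : Y ⟶ Y') :
    f ≫ nonnegProj Y' = nonnegProj Y ≫
      HomologicalComplex.extendMap (HomologicalComplex.restrictionMap f natEmb) natEmb := by
  apply (natEmb.homEquiv _ _).injective
  apply Subtype.ext
  change natEmb.homRestrict _ = natEmb.homRestrict _
  rw [natEmb.homRestrict_precomp, natEmb.homRestrict_comp_extendMap, nonnegProj, nonnegProj,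
    natEmb.homRestrict_liftExtend, natEmb.homRestrict_liftExtend, Category.comp_id,
    Category.id_comp]

lemma isIso_nonnegProj {Y : Cx.{u}} (hY : Nonneg Y) : IsIso (nonnegProj Y) := by
  have : ∀ n, IsIso ((nonnegProj Y).f n) := by
    intro n
    by_cases hn : n < 0
    · have h2 : IsZero (((Y.restriction natEmb).extend natEmb).X n) :=
        HomologicalComplex.isZero_extend_X _ _ _ (by intro i; rw [natEmb_f]; omega)
      exact ⟨0, (hY n hn).eq_of_src _ _, h2.eq_of_src _ _⟩
    · obtain ⟨m, rfl⟩ := Int.eq_ofNat_of_zero_le (not_lt.1 hn)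
      exact (natEmb.isIso_liftExtend_f_iff (i := m) _ (natEmb_hasLift _) rfl).2
        (inferInstanceAs (IsIso (𝟙 _)))
  exact HomologicalComplex.Hom.isIso_of_components _

/-- The restriction to non-negative degrees of a homotopy. -/
lemma nonempty_restriction_homotopy {Y Y' : Cx.{u}} (hY : Nonneg Y) {f f' : Y ⟶ Y'}
    (h : Homotopy f f') : Nonempty (Homotopy (HomologicalComplex.restrictionMap f natEmb)
      (HomologicalComplex.restrictionMap f' natEmb)) := by
  have := isIso_nonnegProj hY
  -- Only the projection of the source has to be inverted, so `Y'` may be nonzero in negative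
  -- degrees.
  have key (f : Y ⟶ Y') : inv (nonnegProj Y) ≫ f ≫ nonnegProj Y' =
      HomologicalComplex.extendMap (HomologicalComplex.restrictionMap f natEmb) natEmb := by
    rw [nonnegProj_naturality, IsIso.inv_hom_id_assoc]
  exact ⟨Homotopy.ofExtend ((Homotopy.ofEq (key f).symm).trans
    (((h.compRight _).compLeft _).trans (Homotopy.ofEq (key f'))))⟩

/-- The counit of the Dold-Kan equivalence. -/
noncomputable def counitDK (K : ChainComplex AddCommGrpCat.{u} ℕ) :
    (AlgebraicTopology.normalizedMooreComplex AddCommGrpCat.{u}).obj (Abelian.DoldKan.Γ.obj K) ≅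
      K :=
  Abelian.DoldKan.equivalence.counitIso.app K

lemma counitDK_naturality {K L : ChainComplex AddCommGrpCat.{u} ℕ} (a : K ⟶ L) :
    (AlgebraicTopology.normalizedMooreComplex AddCommGrpCat.{u}).map (Abelian.DoldKan.Γ.map a) =
      (counitDK K).hom ≫ a ≫ (counitDK L).inv := by
  rw [← Category.assoc, Iso.eq_comp_inv]
  exact Abelian.DoldKan.equivalence.counitIso.hom.naturality a

lemma nonempty_N_Γ_homotopy {K L : ChainComplex AddCommGrpCat.{u} ℕ} {a : K ⟶ L}
    (h : Homotopy a 0) : Nonempty (Homotopy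
      ((AlgebraicTopology.normalizedMooreComplex AddCommGrpCat.{u}).map
        (Abelian.DoldKan.Γ.map a)) 0) := by
  refine ⟨(Homotopy.ofEq (counitDK_naturality a)).trans
    (((h.compRight _).compLeft _).trans (Homotopy.ofEq ?_))⟩
  rw [zero_comp, comp_zero]

lemma nonempty_N_Ninv_homotopy {Y Y' : Cx.{u}} (hY : Nonneg Y) {g : Y ⟶ Y'}
    (h : Homotopy g 0) : Nonempty (Homotopy
      ((AlgebraicTopology.normalizedMooreComplex AddCommGrpCat.{u}).map (Ninv.map g)) 0) := by
  obtain ⟨h'⟩ := nonempty_restriction_homotopy hY h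
  exact nonempty_N_Γ_homotopy h'

/-- `M_#` carries homotopic chain maps to homotopic chain maps. -/
lemma nonempty_sharp_homotopy {Y Y' : Cx.{u}} (hY : Nonneg Y) {f f' : Y ⟶ Y'}
    (h : Homotopy f f') : Nonempty (Homotopy ((sharp M).map f) ((sharp M).map f')) := by
  obtain ⟨h1⟩ := nonempty_N_Ninv_homotopy hY (Homotopy.equivSubZero h.symm)
  -- The passage to simplicial homotopies happens before `⊗ M` is applied, since only these survive
  -- a non-additive functor.
  obtain ⟨H⟩ := AlgebraicTopology.NormalizedMooreComplex.nonempty_homotopy_add (Ninv.map f) h1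
  rw [← Ninv.map_add, add_sub_cancel] at H
  exact ⟨(AlgebraicTopology.NormalizedMooreComplex.mapHomotopy
    (H.whiskerRight (tensorFunctor M))).extend natEmb⟩

lemma quotient_sharp_eq {Y Y' : Cx.{u}} (hY : Nonneg Y) {f f' : Y ⟶ Y'} (h : Homotopy f f') :
    (HomotopyCategory.quotient _ _).map ((sharp M).map f) =
      (HomotopyCategory.quotient _ _).map ((sharp M).map f') :=
  HomotopyCategory.eq_of_homotopy _ _ (nonempty_sharp_homotopy M hY h).some

/-- A quasi-isomorphism of non-negative chain complexes of projectives is a homotopy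
equivalence. -/
lemma exists_homotopyEquiv {Y Y' : Cx.{u}} (hY : Nonneg Y) (hY' : Nonneg Y')
    (pY : ∀ n, Projective (Y.X n)) (pY' : ∀ n, Projective (Y'.X n)) (f : Y ⟶ Y') [QuasiIso f] :
    ∃ e : HomotopyEquiv Y Y', e.hom = f := by
  have := isIso_nonnegProj hY
  have := isIso_nonnegProj hY'
  -- Up to the isomorphisms `nonnegProj`, `f` is the extension of its restriction to degrees indexed
  -- by `ℕ`, where the criterion for complexes of projectives is available.
  let a := HomologicalComplex.restrictionMap f natEmb
  have e : f = nonnegProj Y ≫ HomologicalComplex.extendMap a natEmb ≫ inv (nonnegProj Y') := by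
    rw [← Category.assoc, IsIso.eq_comp_inv, nonnegProj_naturality]
  have e' : HomologicalComplex.extendMap a natEmb = inv (nonnegProj Y) ≫ f ≫ nonnegProj Y' := by
    rw [nonnegProj_naturality, IsIso.inv_hom_id_assoc]
  have q : QuasiIso (HomologicalComplex.extendMap a natEmb) := by
    rw [e']
    infer_instance
  rw [HomologicalComplex.quasiIso_extendMap_iff] at q
  have (n : ℕ) : Projective ((Y.restriction natEmb).X n) := pY _
  have (n : ℕ) : Projective ((Y'.restriction natEmb).X n) := pY' _
  rw [ChainComplex.quasiIso_iff_of_projective,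
    ← HomologicalComplex.homotopyEquivalences_extendMap_iff a natEmb] at q
  obtain ⟨E, hE⟩ := q
  exact ⟨((HomotopyEquiv.ofIso (asIso (nonnegProj Y))).trans E).trans
    (HomotopyEquiv.ofIso (asIso (nonnegProj Y')).symm), by
      rw [e, ← hE]; exact Category.assoc _ _ _⟩

end QuadBype

namespace QuadBype

/-! ### Homology of Moore chain complexes -/

section Moore

variable (A : AddCommGrpCat.{u}) (n : ℤ)

lemma moore_d_next (j : ℤ) : (moore A n).d n j = 0 := by
  by_cases h : (ComplexShape.down ℤ).Rel n j
  · obtain rfl : j = n - 1 := by simp only [ComplexShape.down_Rel] at h; omega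
    exact moore_d' A n
  · exact HomologicalComplex.shape _ _ _ h

/-- The map from the free group of the resolution to the cycles of the Moore chain complex. -/
noncomputable def mooreCycles : resF A ⟶ (moore A n).cycles n :=
  (moore A n).liftCycles (mooreX₁ A n).inv _ rfl (by rw [moore_d_next, comp_zero])

/-- The map from the free group of the resolution to the homology of the Moore chain complex. -/
noncomputable def resClass : resF A ⟶ (moore A n).homology n :=
  mooreCycles A n ≫ (moore A n).homologyπ n

instance : Epi (resClass A n) := by
  have h1 : IsIso ((moore A n).iCycles n) :=
    HomologicalComplex.isIso_iCycles _ n _ rfl (moore_d_next _ _ _)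
  have h2 : mooreCycles A n ≫ (moore A n).iCycles n = (mooreX₁ A n).inv :=
    HomologicalComplex.liftCycles_i _ _ _ _ _
  have h3 : mooreCycles A n = (mooreX₁ A n).inv ≫ inv ((moore A n).iCycles n) := by
    rw [IsIso.eq_comp_inv, h2]
  unfold resClass
  rw [h3]
  infer_instance

lemma resClass_homologyMap {Z : Cx.{u}} (g : moore A n ⟶ Z) (j : ℤ)
    (hj : (ComplexShape.down ℤ).next n = j)
    (hg : ((mooreX₁ A n).inv ≫ g.f n) ≫ Z.d n j = 0) :
    resClass A n ≫ HomologicalComplex.homologyMap g n =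
      Z.liftCycles ((mooreX₁ A n).inv ≫ g.f n) j hj hg ≫ Z.homologyπ n := by
  subst hj
  rw [resClass, Category.assoc, HomologicalComplex.homologyπ_naturality, mooreCycles,
    HomologicalComplex.liftCycles_comp_cyclesMap_assoc]

lemma resd_resClass : resd A ≫ resClass A n = 0 := by
  rw [resClass, mooreCycles, HomologicalComplex.comp_liftCycles_assoc]
  refine HomologicalComplex.liftCycles_homologyπ_eq_zero_of_boundary (i' := n + 1) _ _ _ _
    (mooreX₀ A n).inv ?_
  rw [moore_d, Iso.inv_hom_id_assoc]

lemma resClass_mooreAug : resClass A n ≫ mooreAug A n = resε A := by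
  have h := resClass_homologyMap A n
    (mooreDesc (Z := (HomologicalComplex.single _ (ComplexShape.down ℤ) n).obj A) 0
      (resε A ≫ (HomologicalComplex.singleObjXSelf _ n A).inv)
      (by rw [zero_comp, kernel.condition_assoc, zero_comp]) (by simp)) _ rfl (by simp)
  rw [mooreAug, reassoc_of% h, HomologicalComplex.homologyπ_singleObjHomologySelfIso_hom,
    HomologicalComplex.singleObjCyclesSelfIso_hom, HomologicalComplex.liftCycles_i_assoc,
    mooreDesc_f₁]
  simp

instance : Epi (resε A) := (AddCommGrpCat.epi_iff_surjective _).2 fun a =>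
  ⟨FreeNZ.gen a, FreeNZ.proj_gen a⟩

/-- `resClass` kills the relation group, so it descends along `resε` to a map from `A`; this is the
inverse, as both maps out of `resF A` are epimorphisms. -/
instance : IsIso (mooreAug A n) := by
  refine ⟨Abelian.epiDesc (resε A) (resClass A n) (resd_resClass A n), ?_, ?_⟩
  · rw [← cancel_epi (resClass A n), reassoc_of% (resClass_mooreAug A n),
      Abelian.comp_epiDesc, Category.comp_id]
  · rw [← cancel_epi (resε A), Abelian.comp_epiDesc_assoc, resClass_mooreAug, Category.comp_id]

variable {A}

lemma mooreAug_naturality {A' : AddCommGrpCat.{u}} (φ : A ⟶ A') :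
    HomologicalComplex.homologyMap (mooreMap φ n) n ≫ mooreAug A' n = mooreAug A n ≫ φ := by
  have h1 : (mooreX₁ A n).inv ≫ (mooreMap φ n).f n = resFMap φ ≫ (mooreX₁ A' n).inv := by
    rw [mooreMap, mooreDesc_f₁, Iso.inv_hom_id_assoc]
  have h : resClass A n ≫ HomologicalComplex.homologyMap (mooreMap φ n) n =
      resFMap φ ≫ resClass A' n := by
    rw [resClass_homologyMap A n (mooreMap φ n) _ rfl (by rw [h1]; simp [moore_d_next]), resClass,
      mooreCycles, HomologicalComplex.comp_liftCycles_assoc]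
    simp only [h1]
  rw [← cancel_epi (resClass A n), reassoc_of% h, resClass_mooreAug,
    reassoc_of% (resClass_mooreAug A n), resFMap_ε]

variable (A)

lemma isZero_moore_X (k : ℤ) (h1 : k ≠ n) (h2 : k ≠ n + 1) : IsZero ((moore A n).X k) :=
  HomologicalComplex.isZero_double_X _ _ _ h2 h1

/-- The differential is a kernel inclusion up to isomorphism, so there are no cycles in the upper
degree. The separate variable `k` avoids casts such as that between `n` and `n - 1 + 1`. -/
lemma isZero_moore_homology (k : ℤ) (h : k = n + 1) : IsZero ((moore A n).homology k) := by
  subst h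
  have hd : Mono ((moore A n).d (n + 1) n) := by
    rw [moore_d]
    infer_instance
  have h0 : (moore A n).iCycles (n + 1) = 0 := by
    rw [← cancel_mono ((moore A n).d (n + 1) n), zero_comp, HomologicalComplex.iCycles_d]
  rw [IsZero.iff_id_eq_zero, ← cancel_epi ((moore A n).homologyπ (n + 1))]
  have h1 : 𝟙 ((moore A n).cycles (n + 1)) = 0 := by
    rw [← cancel_mono ((moore A n).iCycles (n + 1)), h0, comp_zero, comp_zero]
  rw [← Category.id_comp ((moore A n).homologyπ (n + 1)), h1]
  simp

lemma projective_moore_X (k : ℤ) : Projective ((moore A n).X k) := by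
  by_cases h1 : k = n
  · subst h1
    exact Projective.of_iso (mooreX₁ A k).symm inferInstance
  · by_cases h2 : k = n + 1
    · subst h2
      exact Projective.of_iso (mooreX₀ A n).symm inferInstance
    · exact Projective.of_iso (isZero_moore_X A n k h1 h2).isoZero.symm inferInstance

/-- This is where leaving out the generator `0` matters: it makes `C(B)` reduced when `B` is. -/
lemma isZero_resF (hA : IsZero A) : IsZero (resF A) := by
  have := AddCommGrpCat.subsingleton_of_isZero hA
  rw [IsZero.iff_id_eq_zero]
  ext1
  apply FreeAbelianGroup.lift_ext
  intro a
  exact absurd (Subsingleton.elim _ _) a.2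

lemma isZero_moore_X_of_isZero (hA : IsZero A) (k : ℤ) : IsZero ((moore A n).X k) := by
  by_cases h1 : k = n
  · subst h1
    exact (isZero_resF A hA).of_iso (mooreX₁ A k)
  · by_cases h2 : k = n + 1
    · subst h2
      exact (IsZero.of_mono (resd A) (isZero_resF A hA)).of_iso (mooreX₀ A n)
    · exact isZero_moore_X A n k h1 h2

end Moore

/-! ### The sum `C(B)`: its homology, its projectivity, and chain maps out of it. -/

section MooreSum

variable (B : GradedObject ℤ AddCommGrpCat.{u})

/-- The inclusion of a summand of `C(B)`. -/
noncomputable def sumι (n : ℤ) : moore (B n) n ⟶ mooreSum.obj B :=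
  Limits.Sigma.ι (fun n => moore (B n) n) n

lemma sumι_map {B B' : GradedObject ℤ AddCommGrpCat.{u}} (φ : B ⟶ B') (n : ℤ) :
    sumι B n ≫ mooreSum.map φ = mooreMap (φ n) n ≫ sumι B' n :=
  Limits.ι_colimMap _ _

open Classical in
/-- The projection onto a summand of `C(B)`. -/
noncomputable def sumπ (n : ℤ) : mooreSum.obj B ⟶ moore (B n) n :=
  Limits.Sigma.desc fun m => if h : m = n then eqToHom (by rw [h]) else 0

lemma sumι_π (n : ℤ) : sumι B n ≫ sumπ B n = 𝟙 _ :=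
  (Limits.Sigma.ι_desc _ _).trans (by simp)

lemma sumι_π_of_ne {m n : ℤ} (h : m ≠ n) : sumι B m ≫ sumπ B n = 0 :=
  (Limits.Sigma.ι_desc _ _).trans (by simp [h])

variable {B}

lemma mooreSum_X_hom_ext {k : ℤ} {T : AddCommGrpCat.{u}} {f g : (mooreSum.obj B).X k ⟶ T}
    (h : ∀ n, (sumι B n).f k ≫ f = (sumι B n).f k ≫ g) : f = g :=
  (isColimitOfPreserves (HomologicalComplex.eval _ _ k)
    (colimit.isColimit (Discrete.functor fun n => moore (B n) n))).hom_ext fun j => h j.as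

variable (B)

/-- Only the summands with index `n` and `n - 1` are nonzero in degree `n`. -/
lemma sumπ_ι_add (n : ℤ) : (sumπ B n ≫ sumι B n).f n +
    (sumπ B (n - 1) ≫ sumι B (n - 1)).f n = 𝟙 _ := by
  apply mooreSum_X_hom_ext
  intro m
  rw [Preadditive.comp_add, ← HomologicalComplex.comp_f, ← HomologicalComplex.comp_f,
    Category.comp_id]
  by_cases h1 : m = n
  · subst h1
    rw [reassoc_of% (sumι_π B m), reassoc_of% (sumι_π_of_ne B (show m ≠ m - 1 by omega)),
      zero_comp, HomologicalComplex.zero_f, add_zero]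
  · by_cases h2 : m = n - 1
    · subst h2
      rw [reassoc_of% (sumι_π B (n - 1)), reassoc_of% (sumι_π_of_ne B h1),
        zero_comp, HomologicalComplex.zero_f, zero_add]
    · exact (isZero_moore_X (B m) m n (Ne.symm h1) (by omega)).eq_of_src _ _

/-- Allows the decomposition of the identity, which holds in a single degree only, to be used in
homology. -/
lemma homologyMap_congr {Y Z : Cx.{u}} {f g : Y ⟶ Z} {n : ℤ} (h : f.f n = g.f n) :
    HomologicalComplex.homologyMap f n = HomologicalComplex.homologyMap g n := by
  rw [← cancel_epi (Y.homologyπ n), HomologicalComplex.homologyπ_naturality,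
    HomologicalComplex.homologyπ_naturality]
  congr 1
  rw [← cancel_mono (Z.iCycles n), HomologicalComplex.cyclesMap_i,
    HomologicalComplex.cyclesMap_i, h]

instance (n : ℤ) : IsIso (HomologicalComplex.homologyMap (sumι B n) n) := by
  refine ⟨HomologicalComplex.homologyMap (sumπ B n) n, ?_, ?_⟩
  · rw [← HomologicalComplex.homologyMap_comp, sumι_π, HomologicalComplex.homologyMap_id]
  · have h1 : HomologicalComplex.homologyMap (sumπ B (n - 1) ≫ sumι B (n - 1)) n = 0 := by
      rw [HomologicalComplex.homologyMap_comp,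
        (isZero_moore_homology (B (n - 1)) (n - 1) n (by omega)).eq_of_tgt
          (HomologicalComplex.homologyMap (sumπ B (n - 1)) n) 0, zero_comp]
    have h2 : HomologicalComplex.homologyMap (𝟙 (mooreSum.obj B)) n =
        HomologicalComplex.homologyMap
          (sumπ B n ≫ sumι B n + sumπ B (n - 1) ≫ sumι B (n - 1)) n :=
      homologyMap_congr (by rw [HomologicalComplex.add_f_apply, sumπ_ι_add]; rfl)
    rw [HomologicalComplex.homologyMap_add, h1, add_zero, HomologicalComplex.homologyMap_id,
      HomologicalComplex.homologyMap_comp] at h2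
    exact h2.symm

/-- The canonical isomorphism `H_n C(B) → B_n`. -/
noncomputable def sumAug (n : ℤ) : (mooreSum.obj B).homology n ⟶ B n :=
  inv (HomologicalComplex.homologyMap (sumι B n) n) ≫ mooreAug (B n) n

instance (n : ℤ) : IsIso (sumAug B n) := by unfold sumAug; infer_instance

lemma sumι_sumAug (n : ℤ) :
    HomologicalComplex.homologyMap (sumι B n) n ≫ sumAug B n = mooreAug (B n) n := by
  rw [sumAug, IsIso.hom_inv_id_assoc]

lemma sumAug_naturality {B B' : GradedObject ℤ AddCommGrpCat.{u}} (φ : B ⟶ B') (n : ℤ) :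
    HomologicalComplex.homologyMap (mooreSum.map φ) n ≫ sumAug B' n = sumAug B n ≫ φ n := by
  rw [← cancel_epi (HomologicalComplex.homologyMap (sumι B n) n),
    reassoc_of% (sumι_sumAug B n), ← HomologicalComplex.homologyMap_comp_assoc, sumι_map,
    HomologicalComplex.homologyMap_comp_assoc, sumι_sumAug, mooreAug_naturality]

lemma inducesId_iff {Y : Cx.{u}} (i : mooreSum.obj (gradedHomology Y) ⟶ Y) :
    InducesId i ↔ ∀ n, HomologicalComplex.homologyMap i n = sumAug (gradedHomology Y) n := by
  refine forall_congr' fun n => ?_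
  rw [← cancel_epi (HomologicalComplex.homologyMap (sumι (gradedHomology Y) n) n), sumι_sumAug,
    ← HomologicalComplex.homologyMap_comp]
  rfl

lemma InducesId.quasiIso {Y : Cx.{u}} {i : mooreSum.obj (gradedHomology Y) ⟶ Y}
    (hi : InducesId i) : QuasiIso i := by
  rw [quasiIso_iff]
  intro n
  rw [quasiIsoAt_iff_isIso_homologyMap, (inducesId_iff i).1 hi n]
  infer_instance

lemma projective_coproduct (g : ℤ → AddCommGrpCat.{u}) [∀ n, Projective (g n)] :
    Projective (∐ g) where
  factors f e he :=
    ⟨Limits.Sigma.desc fun n => Projective.factorThru (Limits.Sigma.ι g n ≫ f) e, by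
      apply Limits.Sigma.hom_ext
      intro n
      rw [Limits.Sigma.ι_desc_assoc, Projective.factorThru_comp]⟩

lemma projective_mooreSum_X (k : ℤ) : Projective ((mooreSum.obj B).X k) := by
  have (n : ℤ) : Projective ((HomologicalComplex.eval AddCommGrpCat.{u} _ k).obj (moore (B n) n)) :=
    projective_moore_X (B n) n k
  exact Projective.of_iso
    (PreservesCoproduct.iso (HomologicalComplex.eval _ _ k) fun n => moore (B n) n).symm
    (projective_coproduct _)

lemma isZero_mooreSum_X {r : ℕ} (hB : ∀ n : ℤ, n < r → IsZero (B n)) (k : ℤ) (hk : k < r) :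
    IsZero ((mooreSum.obj B).X k) := by
  rw [IsZero.iff_id_eq_zero]
  apply mooreSum_X_hom_ext
  intro n
  refine IsZero.eq_of_src ?_ _ _
  by_cases hn : n < r
  · exact isZero_moore_X_of_isZero _ _ (hB n hn) k
  · exact isZero_moore_X _ _ _ (by omega) (by omega)

/-- Every homomorphism `A → H_n Z` is induced by a chain map `C(A, n) → Z`. -/
lemma exists_moore_map {A : AddCommGrpCat.{u}} {n : ℤ} {Z : Cx.{u}} (q : A ⟶ Z.homology n) :
    ∃ g : moore A n ⟶ Z, HomologicalComplex.homologyMap g n = mooreAug A n ≫ q := by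
  -- `q` lifts to cycles on the free group; relations then go to boundaries, and projectivity of the
  -- relation group lifts them to chains in degree `n + 1`.
  let c : resF A ⟶ Z.cycles n := Projective.factorThru (resε A ≫ q) (Z.homologyπ n)
  have hc : c ≫ Z.homologyπ n = resε A ≫ q := Projective.factorThru_comp _ _
  have hex := ShortComplex.exact_of_g_is_cokernel
    (ShortComplex.mk (Z.toCycles (n + 1) n) (Z.homologyπ n) (by simp))
    (Z.homologyIsCokernel (n + 1) n (by simp))
  have h0 : (resd A ≫ c) ≫ Z.homologyπ n = 0 := by
    rw [Category.assoc, hc, kernel.condition_assoc, zero_comp]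
  let b : resK A ⟶ Z.X (n + 1) := hex.liftFromProjective (resd A ≫ c) h0
  have hb : b ≫ Z.toCycles (n + 1) n = resd A ≫ c := hex.liftFromProjective_comp _ h0
  refine ⟨mooreDesc b (c ≫ Z.iCycles n) ?_ (by simp), ?_⟩
  · rw [← Z.toCycles_i, reassoc_of% hb]
  · rw [← cancel_epi (resClass A n), resClass_homologyMap A n _ _ rfl
      (by rw [mooreDesc_f₁, Iso.inv_hom_id_assoc]; simp), reassoc_of% (resClass_mooreAug A n), ← hc]
    congr 1
    rw [← cancel_mono (Z.iCycles n), HomologicalComplex.liftCycles_i, mooreDesc_f₁,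
      Iso.inv_hom_id_assoc]

lemma exists_inducesId (Y : Cx.{u}) :
    ∃ i : mooreSum.obj (gradedHomology Y) ⟶ Y, InducesId i := by
  choose g hg using fun n => exists_moore_map (𝟙 (Y.homology n))
  refine ⟨Limits.Sigma.desc g, fun n => ?_⟩
  rw [Limits.Sigma.ι_desc, hg, Category.comp_id]

end MooreSum

end QuadBype

namespace QuadBype

/-! ### Compatibility of boundary invariants -/

section Compat

variable {B B' : GradedObject ℤ AddCommGrpCat.{u}} {Z Z' : Cx.{u}}

/-- With chosen representatives, an equality of cosets becomes a membership that can be pushed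
forward and pulled back. -/
lemma Boundary.compat_iff_mem {s : Boundary B Z} {s' : Boundary B' Z'} {φ : B ⟶ B'} {Φ : Z ⟶ Z'}
    {x : ∀ n, PseudoHomology n (B (n + 1)) Z} {x' : ∀ n, PseudoHomology n (B' (n + 1)) Z'}
    (hx : ∀ n, QuotientAddGroup.mk (x n) = s.β n)
    (hx' : ∀ n, QuotientAddGroup.mk (x' n) = s'.β n) :
    s.Compat s' φ Φ ↔
      (∀ n, s.b n ≫ HomologicalComplex.homologyMap Φ n = φ (n + 1) ≫ s'.b n) ∧
      ∀ n, PseudoHomology.push n _ Φ (x n) - PseudoHomology.pull n (φ (n + 1)) Z' (x' n) ∈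
        deltaIm n (B (n + 1)) Z' (s'.b (n + 1)) := by
  have key (n : ℤ) (h) : QuotientAddGroup.map _ (deltaIm n (B (n + 1)) Z' (s'.b (n + 1)))
        (PseudoHomology.push n (B (n + 1)) Φ) h (s.β n) =
      QuotientAddGroup.map _ (deltaIm n (B (n + 1)) Z' (s'.b (n + 1)))
        (PseudoHomology.pull n (φ (n + 1)) Z')
        (deltaIm_pull n (φ (n + 1)) Z' (s'.b (n + 1))) (s'.β n) ↔
      PseudoHomology.push n _ Φ (x n) - PseudoHomology.pull n (φ (n + 1)) Z' (x' n) ∈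
        deltaIm n (B (n + 1)) Z' (s'.b (n + 1)) := by
    rw [← hx n, ← hx' n, QuotientAddGroup.map_mk, QuotientAddGroup.map_mk, eq_comm,
      QuotientAddGroup.eq, neg_add_eq_sub]
  constructor
  · rintro ⟨h, h'⟩
    exact ⟨h, fun n => (key n _).1 (h' n)⟩
  · rintro ⟨h, h'⟩
    exact ⟨h, fun n => (key n _).2 (h' n)⟩

lemma Boundary.exists_rep (s : Boundary B Z) :
    ∃ x : ∀ n, PseudoHomology n (B (n + 1)) Z, ∀ n, QuotientAddGroup.mk (x n) = s.β n :=
  ⟨fun n => (QuotientAddGroup.mk_surjective (s.β n)).choose,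
    fun n => (QuotientAddGroup.mk_surjective (s.β n)).choose_spec⟩

lemma PseudoHomology.pull_pull (n : ℤ) {A A' A'' : AddCommGrpCat.{u}} (φ : A ⟶ A') (ψ : A' ⟶ A'')
    (x : PseudoHomology n A'' Z) :
    PseudoHomology.pull n φ Z (PseudoHomology.pull n ψ Z x) =
      PseudoHomology.pull n (φ ≫ ψ) Z x := by
  have h : mooreMap (φ ≫ ψ) n = mooreMap φ n ≫ mooreMap ψ n := (mooreFunctor n).map_comp φ ψ
  rw [pull_apply, pull_apply, pull_apply, h, Functor.map_comp, Category.assoc]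

lemma PseudoHomology.pull_id (n : ℤ) (A : AddCommGrpCat.{u}) (x : PseudoHomology n A Z) :
    PseudoHomology.pull n (𝟙 A) Z x = x := by
  have h : mooreMap (𝟙 A) n = 𝟙 _ := (mooreFunctor n).map_id A
  rw [pull_apply, h]
  exact (congrArg (· ≫ x) ((HomotopyCategory.quotient _ _).map_id _)).trans (Category.id_comp x)

lemma PseudoHomology.push_pull (n : ℤ) {A A' : AddCommGrpCat.{u}} (φ : A ⟶ A') (Φ : Z ⟶ Z')
    (x : PseudoHomology n A' Z) :
    PseudoHomology.push n A Φ (PseudoHomology.pull n φ Z x) =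
      PseudoHomology.pull n φ Z' (PseudoHomology.push n A' Φ x) := by
  rw [push_apply, pull_apply, pull_apply, push_apply, Category.assoc]

/-- Compatibility is inherited by homotopy inverses. -/
lemma Boundary.Compat.inv {s : Boundary B Z} {s' : Boundary B' Z'} {φ : B ⟶ B'} {Φ : Z ⟶ Z'}
    (h : s.Compat s' φ Φ) {ψ : B' ⟶ B} {Ψ : Z' ⟶ Z} (hψφ : ψ ≫ φ = 𝟙 _)
    (hΦΨ : (HomotopyCategory.quotient _ _).map Φ ≫ (HomotopyCategory.quotient _ _).map Ψ = 𝟙 _) :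
    s'.Compat s ψ Ψ := by
  obtain ⟨x, hx⟩ := s.exists_rep
  obtain ⟨x', hx'⟩ := s'.exists_rep
  rw [Boundary.compat_iff_mem hx hx'] at h
  rw [Boundary.compat_iff_mem hx' hx]
  obtain ⟨h1, h2⟩ := h
  have hn (n : ℤ) : ψ n ≫ φ n = 𝟙 _ := congrFun hψφ n
  have hH (n : ℤ) : HomologicalComplex.homologyMap Φ n ≫ HomologicalComplex.homologyMap Ψ n =
      𝟙 _ := by
    have h := congrArg (fun t => hoHomologyMap t n)
      ((Functor.map_comp _ Φ Ψ).trans (hΦΨ.trans (CategoryTheory.Functor.map_id _ _).symm))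
    simpa only [hoHomologyMap_quotient, HomologicalComplex.homologyMap_comp,
      HomologicalComplex.homologyMap_id] using h
  have hb (n : ℤ) : s'.b n ≫ HomologicalComplex.homologyMap Ψ n = ψ (n + 1) ≫ s.b n := by
    have h3 : s'.b n = ψ (n + 1) ≫ s.b n ≫ HomologicalComplex.homologyMap Φ n := by
      rw [h1, ← Category.assoc, hn, Category.id_comp]
    rw [h3, Category.assoc, Category.assoc, hH, Category.comp_id]
  refine ⟨hb, fun n => ?_⟩
  -- Push the defect of compatibility forward along `Ψ` and pull it back along `ψ`: up to sign the
  -- result is the defect of the inverse pair. Only the one-sided identities `ψφ = 1` and `ΦΨ ≃ 1`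
  -- enter.
  have h4 := deltaIm_push n _ (s'.b (n + 1)) (s.b (n + 1)) (ψ (n + 1 + 1)) Ψ (hb (n + 1))
    (deltaIm_pull n (ψ (n + 1)) Z' (s'.b (n + 1)) (h2 n))
  rw [AddSubgroup.mem_comap, map_sub, map_sub, PseudoHomology.pull_pull, hn,
    PseudoHomology.pull_id, PseudoHomology.push_pull] at h4
  have h5 : PseudoHomology.push n _ Ψ (PseudoHomology.push n _ Φ (x n)) = x n := by
    rw [PseudoHomology.push_apply, PseudoHomology.push_apply, Category.assoc]
    exact (congrArg (x n ≫ ·) hΦΨ).trans (Category.comp_id _)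
  rw [h5] at h4
  simpa using neg_mem h4

/-- Boundary invariants can be transported along an isomorphism of graded groups and a chain
map. -/
lemma Boundary.exists_compat (s : Boundary B Z) {φ : B ⟶ B'} {ψ : B' ⟶ B} (hφψ : φ ≫ ψ = 𝟙 _)
    (Φ : Z ⟶ Z') : ∃ s' : Boundary B' Z', s.Compat s' φ Φ := by
  obtain ⟨x, hx⟩ := s.exists_rep
  have hn (n : ℤ) : φ n ≫ ψ n = 𝟙 _ := congrFun hφψ n
  have hmu (n : ℤ) : PseudoHomology.mu n (B (n + 1)) Z (x n) = mooreAug (B (n + 1)) n ≫ s.b n := by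
    rw [← s.mu_β n, ← hx n]
    rfl
  -- Compatibility suggests the choice: pull the invariants back along `ψ` and push them forward
  -- along `Φ`.
  let s' : Boundary B' Z' :=
    { b := fun n => ψ (n + 1) ≫ s.b n ≫ HomologicalComplex.homologyMap Φ n
      β := fun n => QuotientAddGroup.mk
        (PseudoHomology.push n _ Φ (PseudoHomology.pull n (ψ (n + 1)) Z (x n)))
      mu_β := fun n => by
        change PseudoHomology.mu n _ Z' _ = _
        rw [← Category.assoc, ← mooreAug_naturality, Category.assoc, ← reassoc_of% (hmu n)]
        obtain ⟨f, hf⟩ := (HomotopyCategory.quotient _ _).map_surjective (x n)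
        rw [← hf, PseudoHomology.push_apply, PseudoHomology.pull_apply, ← Functor.map_comp,
          ← Functor.map_comp, PseudoHomology.mu_quotient, PseudoHomology.mu_quotient,
          HomologicalComplex.homologyMap_comp, HomologicalComplex.homologyMap_comp,
          Category.assoc] }
  refine ⟨s', (Boundary.compat_iff_mem hx fun n => rfl).2 ⟨fun n => ?_, fun n => ?_⟩⟩
  · exact ((Category.id_comp _).symm.trans (congrArg (· ≫ s.b n ≫ _) (hn (n + 1)).symm)).trans
      (Category.assoc _ _ _)
  · rw [← PseudoHomology.push_pull, PseudoHomology.pull_pull, hn, PseudoHomology.pull_id, sub_self]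
    exact zero_mem _

end Compat

/-! ### The functor to homological bypes -/

section Functor

variable {M : QuadraticModule.{u}} {r : ℕ}

lemma homologyMap_hom_inv {Y Y' : Cx.{u}} (e : HomotopyEquiv Y Y') (n : ℤ) :
    HomologicalComplex.homologyMap e.hom n ≫ HomologicalComplex.homologyMap e.inv n = 𝟙 _ := by
  rw [← HomologicalComplex.homologyMap_comp, e.homotopyHomInvId.homologyMap_eq,
    HomologicalComplex.homologyMap_id]

lemma quotient_hom_inv {Y Y' : Cx.{u}} (e : HomotopyEquiv Y Y') :
    (HomotopyCategory.quotient _ _).map e.hom ≫ (HomotopyCategory.quotient _ _).map e.inv =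
      𝟙 _ := by
  rw [← Functor.map_comp, HomotopyCategory.eq_of_homotopy _ _ e.homotopyHomInvId,
    CategoryTheory.Functor.map_id]

lemma quotient_sharp_hom_inv {Y Y' : Cx.{u}} (hY : Nonneg Y) (e : HomotopyEquiv Y Y') :
    (HomotopyCategory.quotient _ _).map ((sharp M).map e.hom) ≫
      (HomotopyCategory.quotient _ _).map ((sharp M).map e.inv) = 𝟙 _ := by
  rw [← Functor.map_comp, ← Functor.map_comp, quotient_sharp_eq M hY e.homotopyHomInvId,
    CategoryTheory.Functor.map_id, CategoryTheory.Functor.map_id]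

lemma nonneg_of_reduced {Y : Cx.{u}} (h : ∀ n : ℤ, n < r → IsZero (Y.X n)) : Nonneg Y :=
  fun n hn => h n (by omega)

lemma Bype.nonneg (X : Bype M r) : Nonneg X.Y := nonneg_of_reduced X.reduced

lemma Bype.projective (X : Bype M r) (n : ℤ) : Projective (X.Y.X n) :=
  have := X.free n
  projective_of_free _

lemma nonneg_mooreSum {B : GradedObject ℤ AddCommGrpCat.{u}}
    (hB : ∀ n : ℤ, n < r → IsZero (B n)) : Nonneg (mooreSum.obj B) :=
  nonneg_of_reduced (isZero_mooreSum_X B hB)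

lemma Bype.nonneg_mooreSum_homology (X : Bype M r) :
    Nonneg (mooreSum.obj (gradedHomology X.Y)) :=
  nonneg_mooreSum (r := r) fun n hn => isZero_homology (X.reduced n hn)

lemma Bype.exists_homotopyEquiv (X : Bype M r) {i : mooreSum.obj (gradedHomology X.Y) ⟶ X.Y}
    (hi : InducesId i) :
    ∃ e : HomotopyEquiv (mooreSum.obj (gradedHomology X.Y)) X.Y, e.hom = i :=
  have := hi.quasiIso
  QuadBype.exists_homotopyEquiv X.nonneg_mooreSum_homology X.nonneg (projective_mooreSum_X _)
    X.projective i

/-- The condition on morphisms of `Hbype_r(M)`, in terms of the chain map `C(φ) + α`. -/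
lemma Boundary.exists_compat_sharpAdd_iff {B B' : GradedObject ℤ AddCommGrpCat.{u}}
    {s : Boundary B ((sharp M).obj (mooreSum.obj B))}
    {s' : Boundary B' ((sharp M).obj (mooreSum.obj B'))} {φ : B ⟶ B'} :
    (∃ α : mooreSum.obj B ⟶ mooreSum.obj B',
      (∀ n, HomologicalComplex.homologyMap α n = 0) ∧
      s.Compat s' φ (sharpAdd M (mooreSum.map φ) α)) ↔
    ∃ a : mooreSum.obj B ⟶ mooreSum.obj B',
      (∀ n, HomologicalComplex.homologyMap a n ≫ sumAug B' n = sumAug B n ≫ φ n) ∧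
      s.Compat s' φ ((sharp M).map a) := by
  constructor
  · rintro ⟨α, h, h'⟩
    -- The expression `sharpAdd` is `M_#` of this sum, and `H_* α = 0` says that the sum and `C(φ)`
    -- agree in homology.
    refine ⟨mooreSum.map φ + α, fun n => ?_, ?_⟩
    · rw [HomologicalComplex.homologyMap_add, h, add_zero, sumAug_naturality]
    · rwa [sharp_map_add]
  · rintro ⟨a, h, h'⟩
    refine ⟨a - mooreSum.map φ, fun n => ?_, ?_⟩
    · rw [HomologicalComplex.homologyMap_sub, ← cancel_mono (sumAug B' n), Preadditive.sub_comp,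
        h, sumAug_naturality, sub_self, zero_comp]
    · rwa [← sharp_map_add, add_sub_cancel]

/-- A morphism of homological bypes is an isomorphism if its components are. -/
lemma HBype.isIso_of_components {X X' : HBype M r} (f : X ⟶ X')
    (h : ∀ n, IsIso (HBype.Hom.hom f n)) : IsIso f := by
  obtain ⟨a, ha, hc⟩ := Boundary.exists_compat_sharpAdd_iff.1 f.compat
  have hq : QuasiIso a := by
    rw [quasiIso_iff]
    intro n
    rw [quasiIsoAt_iff_isIso_homologyMap]
    have h1 : HomologicalComplex.homologyMap a n =
        (sumAug X.B n ≫ HBype.Hom.hom f n) ≫ inv (sumAug X'.B n) := by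
      rw [IsIso.eq_comp_inv, ha]
    rw [h1]
    infer_instance
  obtain ⟨e, rfl⟩ := exists_homotopyEquiv (nonneg_mooreSum X.reduced) (nonneg_mooreSum X'.reduced)
    (projective_mooreSum_X _) (projective_mooreSum_X _) a
  let ψ : X'.B ⟶ X.B := fun n => inv (HBype.Hom.hom f n)
  have h1 : HBype.Hom.hom f ≫ ψ = 𝟙 _ := funext fun n => IsIso.hom_inv_id (HBype.Hom.hom f n)
  have h2 : ψ ≫ HBype.Hom.hom f = 𝟙 _ := funext fun n => IsIso.inv_hom_id (HBype.Hom.hom f n)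
  -- A homotopy inverse of the chain map behind `f` realizes the inverse of `f`. It need not be of
  -- the form `C(ψ)`; the freedom in `α` absorbs the difference.
  let g : X' ⟶ X := HBype.Hom.mk ψ (Boundary.exists_compat_sharpAdd_iff.2 ⟨e.inv, fun n => by
    rw [← cancel_mono (HBype.Hom.hom f n), Category.assoc, ← ha, Category.assoc]
    exact ((reassoc_of% (homologyMap_hom_inv e.symm n)) (sumAug X'.B n)).trans
      ((congrArg (_ ≫ ·) (IsIso.inv_hom_id (HBype.Hom.hom f n))).trans (Category.comp_id _)).symm,
    hc.inv h2 (quotient_sharp_hom_inv (nonneg_mooreSum X.reduced) e)⟩)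
  exact ⟨g, HBype.Hom.ext h1, HBype.Hom.ext h2⟩

variable {X X' : Bype M r}
  {s : Boundary (gradedHomology X.Y) ((sharp M).obj (mooreSum.obj (gradedHomology X.Y)))}
  {s' : Boundary (gradedHomology X'.Y) ((sharp M).obj (mooreSum.obj (gradedHomology X'.Y)))}
  {i : mooreSum.obj (gradedHomology X.Y) ⟶ X.Y}
  {i' : mooreSum.obj (gradedHomology X'.Y) ⟶ X'.Y}

/-- Invariants are transported forward only, so those of `X` are carried along a homotopy inverse of
`i`, and the compatibility is then inverted. -/
lemma Bype.exists_boundary (hi : InducesId i) :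
    ∃ s : Boundary (gradedHomology X.Y) ((sharp M).obj (mooreSum.obj (gradedHomology X.Y))),
      s.Compat X.bdry (𝟙 (gradedHomology X.Y)) ((sharp M).map i) := by
  obtain ⟨e, rfl⟩ := X.exists_homotopyEquiv hi
  obtain ⟨s, hs⟩ := X.bdry.exists_compat (Category.comp_id (𝟙 (gradedHomology X.Y)))
    ((sharp M).map e.inv)
  exact ⟨s, hs.inv (Category.comp_id _) (quotient_sharp_hom_inv X.nonneg e.symm)⟩

lemma Bype.compat_inv (e : HomotopyEquiv (mooreSum.obj (gradedHomology X.Y)) X.Y)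
    (hs : s.Compat X.bdry (𝟙 (gradedHomology X.Y)) ((sharp M).map e.hom)) :
    X.bdry.Compat s (𝟙 (gradedHomology X.Y)) ((sharp M).map e.inv) :=
  hs.inv (Category.comp_id _) (quotient_sharp_hom_inv X.nonneg_mooreSum_homology e)

lemma homologyMap_inv_sumAug {Y : Cx.{u}}
    (e : HomotopyEquiv (mooreSum.obj (gradedHomology Y)) Y) (hi : InducesId e.hom) (n : ℤ) :
    HomologicalComplex.homologyMap e.inv n ≫ sumAug (gradedHomology Y) n = 𝟙 _ := by
  rw [← (inducesId_iff _).1 hi]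
  exact homologyMap_hom_inv e.symm n

/-- `H_* f` is a morphism of homological bypes, for each morphism `f` of bypes. -/
lemma Bype.Hom.compat_homology (f : Bype.Hom X X') (hi : InducesId i) (hi' : InducesId i')
    (hs : s.Compat X.bdry (𝟙 (gradedHomology X.Y)) ((sharp M).map i))
    (hs' : s'.Compat X'.bdry (𝟙 (gradedHomology X'.Y)) ((sharp M).map i')) :
    ∃ α : mooreSum.obj (gradedHomology X.Y) ⟶ mooreSum.obj (gradedHomology X'.Y),
      (∀ n, HomologicalComplex.homologyMap α n = 0) ∧
      s.Compat s' (gradedHomologyMap f.hom)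
        (sharpAdd M (mooreSum.map (gradedHomologyMap f.hom)) α) := by
  obtain ⟨e', rfl⟩ := X'.exists_homotopyEquiv hi'
  obtain ⟨f, f₀, rfl, hf⟩ := f
  -- The chain map is `f` conjugated by the comparison maps, with the homotopy inverse of `i'`.
  refine Boundary.exists_compat_sharpAdd_iff.2
    ⟨i ≫ f₀ ≫ e'.inv, fun n => ?_, ?_⟩
  · rw [HomologicalComplex.homologyMap_comp, HomologicalComplex.homologyMap_comp, Category.assoc,
      Category.assoc]
    have h1 := homologyMap_inv_sumAug e' hi' n
    rw [(inducesId_iff i).1 hi n]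
    refine (congrArg (fun t => sumAug (gradedHomology X.Y) n ≫
      HomologicalComplex.homologyMap f₀ n ≫ t) h1).trans ?_
    rw [Category.comp_id, gradedHomologyMap, hoHomologyMap_quotient]
  · have h := hs.comp (hf.comp (X'.compat_inv e' hs'))
    rw [Category.comp_id, Category.id_comp, ← Functor.map_comp, ← Functor.map_comp] at h
    exact h

/-- Each morphism of homological bypes between bypes is induced by a morphism of bypes. -/
lemma Bype.exists_hom (hi : InducesId i) (hi' : InducesId i')
    (hs : s.Compat X.bdry (𝟙 (gradedHomology X.Y)) ((sharp M).map i))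
    (hs' : s'.Compat X'.bdry (𝟙 (gradedHomology X'.Y)) ((sharp M).map i'))
    (φ : HBype.Hom (X.toHBype s) (X'.toHBype s')) :
    ∃ f : Bype.Hom X X', gradedHomologyMap f.hom = φ.hom := by
  obtain ⟨e, rfl⟩ := X.exists_homotopyEquiv hi
  obtain ⟨(φ : gradedHomology X.Y ⟶ gradedHomology X'.Y), hφ⟩ := φ
  obtain ⟨a, ha, hc⟩ := (Boundary.exists_compat_sharpAdd_iff (s := s) (s' := s')).1 hφ
  -- Undo the conjugation: `a` realizes `φ` between the Moore sums.
  let f₀ : X.Y ⟶ X'.Y := e.inv ≫ a ≫ i'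
  have hf : gradedHomologyMap ((HomotopyCategory.quotient _ _).map f₀) = φ := by
    funext n
    have h1 := ha n
    rw [gradedHomologyMap, hoHomologyMap_quotient, HomologicalComplex.homologyMap_comp,
      HomologicalComplex.homologyMap_comp, (inducesId_iff i').1 hi' n]
    refine (congrArg (HomologicalComplex.homologyMap e.inv n ≫ ·) h1).trans ?_
    exact (reassoc_of% (homologyMap_inv_sumAug e hi n)) _
  refine ⟨⟨(HomotopyCategory.quotient _ _).map f₀, f₀, rfl, ?_⟩, hf⟩
  have h := (X.compat_inv e hs).comp (hc.comp hs')
  rw [Category.comp_id, Category.id_comp, ← Functor.map_comp, ← Functor.map_comp] at h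
  rwa [hf]

/-- A morphism of bypes is an isomorphism if it induces isomorphisms in homology. -/
lemma Bype.isIso_of_homology (f : X ⟶ X')
    (h : ∀ n, IsIso (gradedHomologyMap (Bype.Hom.hom f) n)) : IsIso f := by
  obtain ⟨f, f₀, rfl, hf⟩ := f
  have hq : QuasiIso f₀ := by
    rw [quasiIso_iff]
    intro n
    rw [quasiIsoAt_iff_isIso_homologyMap, ← hoHomologyMap_quotient]
    exact h n
  obtain ⟨e, rfl⟩ := QuadBype.exists_homotopyEquiv X.nonneg X'.nonneg X.projective X'.projective f₀
  let g : X' ⟶ X := Bype.Hom.mk ((HomotopyCategory.quotient _ _).map e.inv) ⟨e.inv, rfl,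
    hf.inv (by rw [← gradedHomologyMap_comp]
               exact (congrArg _ (quotient_hom_inv e.symm)).trans (gradedHomologyMap_id _))
      (quotient_sharp_hom_inv X.nonneg e)⟩
  exact ⟨g, Bype.Hom.ext (quotient_hom_inv e), Bype.Hom.ext (quotient_hom_inv e.symm)⟩

/-- The functor `h : bype_r(M) → Hbype_r(M)` given by chain maps `i` and boundary invariants
which are compatible with `M_# i`. -/
noncomputable def homologyBype
    {i : ∀ X : Bype M r, mooreSum.obj (gradedHomology X.Y) ⟶ X.Y} (hi : ∀ X, InducesId (i X))
    {s : ∀ X : Bype M r,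
      Boundary (gradedHomology X.Y) ((sharp M).obj (mooreSum.obj (gradedHomology X.Y)))}
    (hs : ∀ X, (s X).Compat X.bdry (𝟙 (gradedHomology X.Y)) ((sharp M).map (i X))) :
    Bype M r ⥤ HBype M r where
  obj X := X.toHBype (s X)
  map {X X'} f := HBype.Hom.mk (gradedHomologyMap (Bype.Hom.hom f))
    (Bype.Hom.compat_homology f (hi X) (hi X') (hs X) (hs X'))
  map_id X := HBype.Hom.ext (gradedHomologyMap_id X.Y)
  map_comp f g := HBype.Hom.ext (gradedHomologyMap_comp (Bype.Hom.hom f) (Bype.Hom.hom g))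

/-- Every homological bype comes from boundary invariants of the chain complex `C(B)`. -/
lemma HBype.exists_bype (W : HBype M r) :
    ∃ bd : Boundary (gradedHomology (mooreSum.obj W.B)) ((sharp M).obj (mooreSum.obj W.B)),
      bd.Compat W.bdry (fun n => sumAug W.B n) (𝟙 _) := by
  let φ : W.B ⟶ gradedHomology (mooreSum.obj W.B) := fun n => inv (sumAug W.B n)
  let ψ : gradedHomology (mooreSum.obj W.B) ⟶ W.B := fun n => sumAug W.B n
  obtain ⟨bd, h⟩ := W.bdry.exists_compat (φ := φ) (ψ := ψ)
    (funext fun n => IsIso.inv_hom_id (sumAug W.B n)) (𝟙 _)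
  exact ⟨bd, h.inv (ψ := ψ) (funext fun n => IsIso.hom_inv_id (sumAug W.B n)) (by simp)⟩

end Functor

end QuadBype

open QuadBype
theorem mainTheorem11 (M : QuadraticModule.{u}) (r : ℕ) :
    (∀ X : Bype M r, ∃ i : mooreSum.obj (gradedHomology X.Y) ⟶ X.Y, QuasiIso i ∧ InducesId i) ∧
    ∀ i : (∀ X : Bype M r, mooreSum.obj (gradedHomology X.Y) ⟶ X.Y), (∀ X, InducesId (i X)) →
      ∃ h : Bype M r ⥤ HBype M r,
        (∀ X : Bype M r,
          ∃ s : Boundary (gradedHomology X.Y)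
              ((sharp M).obj (mooreSum.obj (gradedHomology X.Y))),
            s.Compat X.bdry (𝟙 (gradedHomology X.Y)) ((sharp M).map (i X)) ∧
            h.obj X = X.toHBype s) ∧
        h ⋙ HBype.forget M r = Bype.homology M r ∧
        h.ReflectsIsomorphisms ∧ h.EssSurj ∧ h.Full := by
  refine ⟨fun X => ?_, fun i hi => ?_⟩
  · obtain ⟨i, hi⟩ := exists_inducesId X.Y
    exact ⟨i, hi.quasiIso, hi⟩
  choose s hs using fun X => Bype.exists_boundary (hi X)
  refine ⟨homologyBype hi hs, fun X => ⟨s X, hs X, rfl⟩, rfl, ⟨fun {X X'} f hf => ?_⟩,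
    ⟨fun W => ?_⟩, ⟨fun {X X'} φ => ?_⟩⟩
  · refine Bype.isIso_of_homology f fun n => ?_
    -- Isomorphy passes to the homology groups, and there a morphism of bypes is detected.
    have h1 : IsIso ((HBype.forget M r).map ((homologyBype hi hs).map f)) := inferInstance
    have h2 : IsIso (gradedHomologyMap (Bype.Hom.hom f)) := h1
    exact (isIso_pi_iff (gradedHomologyMap (Bype.Hom.hom f))).1 h2 n
  · obtain ⟨bd, hbd⟩ := W.exists_bype
    let X : Bype M r :=
      { Y := mooreSum.obj W.B
        free := fun n => have := projective_mooreSum_X W.B n; free_of_projective _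
        reduced := isZero_mooreSum_X W.B W.reduced
        bdry := bd }
    let ψ : gradedHomology X.Y ⟶ W.B := fun n => sumAug W.B n
    have hc := (hs X).comp hbd
    rw [Category.id_comp, Category.comp_id] at hc
    -- The chosen `i X` goes from `C(H_* C(B))` to `C(B)` and need not be `C` of the canonical
    -- isomorphism `H_* C(B) → B`, but it induces the same map in homology, which is all that is
    -- required.
    let f : (homologyBype hi hs).obj X ⟶ W := HBype.Hom.mk ψ
      (Boundary.exists_compat_sharpAdd_iff.2 ⟨i X, fun n =>
        congrArg (· ≫ sumAug W.B n) ((inducesId_iff (i X)).1 (hi X) n), hc⟩)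
    have : IsIso f := HBype.isIso_of_components f fun n => inferInstanceAs (IsIso (sumAug W.B n))
    exact ⟨X, ⟨asIso f⟩⟩
  · obtain ⟨f, hf⟩ := Bype.exists_hom (hi X) (hi X') (hs X) (hs X') φ
    exact ⟨f, HBype.Hom.ext hf⟩
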